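/- Let $d\ge 1$, let $P_\star$ be a probability distribution on $\mathbb{R}^d$ with finite second moments, $X_\star\sim P_\star$, and for $n\in\mathbb{N}$ let $\boldsymbol{X}\in\mathbb{R}^{n\times d}$ have i.i.d. rows of law $P_\star$. Let $\mathbb{S}^d$ be the symmetric and $\mathbb{S}^d_+$ the positive semidefinite real $d\times d$ matrices, $\langle A,B\rangle=\operatorname{tr}(A^\top B)$, and $\preceq$ the Loewner order. For $S\in\mathbb{S}^d_+$ put $\boldsymbol{H}_S=\boldsymbol{X}S^{1/2}+\boldsymbol{Z}$, where $\boldsymbol{Z}\in\mathbb{R}^{n\times d}$ has i.i.d. standard Gaussian entries and is independent of $\boldsymbol{X}$. Assume (WC): (a) for each $S\in\mathbb{S}^d_+$ the Bayes-optimal denoisers $y\mapsto\mathbb{E}[\boldsymbol{X}\mid\boldsymbol{H}_S=y]$ (given by Bayes' formula) are Lipschitz in the Frobenius norm with a constant that does not depend on $n$; (b) there is a constant $B<\infty$ with $\|\mathbb{E}[\Psi_n(\boldsymbol{H}_S)]\|_{\mathrm{op}}\le B$ for all $n$ and all $S\in\mathbb{S}^d_+$, where $\Psi_n(\boldsymbol{H}_S)$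 is the $d^2\times d^2$ matrix with entry $\frac1n\langle C_{ik},C_{jl}\rangle$ in row $(i,j)$ and column $(k,l)$, and $C_{kl}$ is the $n\times n$ matrix $[C_{kl}]_{ab}=\operatorname{Cov}(X_{ak},X_{bl}\mid\boldsymbol{H}_S)$. Let $\Lambda_1,\dots,\Lambda_K\in\mathbb{S}^d$ and $\mathcal{T}(Q)=\sum_{k=1}^K\Lambda_kQ\Lambda_k$, and assume that $Y\mapsto\langle\mathcal{T}(Y),Y\rangle$ is convex on $\mathbb{S}^d$. Then for every $S\in\mathbb{S}^d_+$ the limit $$\psi(S)=\lim_{n\to\infty}\frac1n\,\mathbb{E}\bigl[\mathbb{E}[\boldsymbol{X}\mid\boldsymbol{H}_S]^\top\,\mathbb{E}[\boldsymbol{X}\mid\boldsymbol{H}_S]\bigr]$$ exists. Let $D_\star(R)$ be the relative entropy of the law of $R^{1/2}X_\star+Z$ with respect to the law of $Z$, where $Z\sim\mathsf{N}(0,I_d)$ is independent of $X_\star$, and let $\mathcal{Q}=\{Q\in\mathbb{S}^d_+:Q\preceq\mathbb{E}[X_\star X_\star^\top]\}$. Then every maximizer $Q^\star$ over $\mathcal{Q}$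 of $$Q\mapsto\inf_{R\in\mathbb{S}^d_+}\Bigl\{D_\star(R)+\tfrac14\langle\mathcal{T}(Q),Q\rangle-\tfrac12\langle R,Q\rangle\Bigr\}\in[-\infty,\infty)$$ satisfies $\mathcal{T}(Q^\star)=\mathcal{T}\bigl(\psi(\mathcal{T}(Q^\star))\bigr)$, that is, the effective SNR $S^\star=\mathcal{T}(Q^\star)$ is a fixed point $S^\star=\mathcal{T}(\psi(S^\star))$ of Bayes-optimal state evolution. If moreover $\bigcap_{k=1}^K\ker\Lambda_k=\{0\}$ (no direction of the signal is left out of all the observations), then $Q^\star=\psi(\mathcal{T}(Q^\star))$. -/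

import Mathlib

open MeasureTheory ProbabilityTheory Filter Topology
open scoped MatrixOrder

noncomputable section

namespace MTP

/-- An `n × d` real matrix (the value of a signal or of an observation); row `i` is `x i`. -/
abbrev Sig (n d : ℕ) : Type := Fin n → Fin d → ℝ

variable {n d K : ℕ}

/-- Squared Frobenius norm. -/
def frobSq (x : Sig n d) : ℝ := ∑ i, ∑ k, x i k ^ 2

/-- The noiseless output `x S^{1/2}` of the Gaussian channel with SNR matrix `S`, where
`S^{1/2}` is the positive semidefinite square root of `S`. -/
def chanMean (S : Matrix (Fin d) (Fin d) ℝ) (x : Sig n d) : Sig n d :=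
  fun i k => ∑ l, x i l * (CFC.sqrt S) l k

/-- The law of an `n × d` matrix with independent standard Gaussian entries. -/
def noiseLaw (n d : ℕ) : Measure (Sig n d) :=
  Measure.pi fun _ => Measure.pi fun _ => gaussianReal 0 1

/-- The law of `H_S = X S^{1/2} + Z`, where `X` has law `μ` and `Z` is independent standard
Gaussian noise. -/
def channelLaw (μ : Measure (Sig n d)) (S : Matrix (Fin d) (Fin d) ℝ) : Measure (Sig n d) :=
  (μ.prod (noiseLaw n d)).map fun p => chanMean S p.1 + p.2

/-- The likelihood of `x` given `H_S = y`, up to a factor that does not depend on `x`. -/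
def lik (S : Matrix (Fin d) (Fin d) ℝ) (x y : Sig n d) : ℝ :=
  Real.exp (-(1 / 2) * frobSq (y - chanMean S x))

/-- Posterior expectation `E[f(X) | H_S = y]`, by Bayes' formula. -/
def posterior (μ : Measure (Sig n d)) (S : Matrix (Fin d) (Fin d) ℝ) (f : Sig n d → ℝ)
    (y : Sig n d) : ℝ :=
  (∫ x, f x * lik S x y ∂μ) / ∫ x, lik S x y ∂μ

/-- The Bayes-optimal denoiser `η(y; S) = E[X | H_S = y]`. -/
def denoiser (μ : Measure (Sig n d)) (S : Matrix (Fin d) (Fin d) ℝ) (y : Sig n d) : Sig n d :=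
  fun i k => posterior μ S (fun x => x i k) y

/-- The posterior covariance `Cov(X_{ik}, X_{jl} | H_S = y)`. -/
def postCov (μ : Measure (Sig n d)) (S : Matrix (Fin d) (Fin d) ℝ) (y : Sig n d)
    (i : Fin n) (k : Fin d) (j : Fin n) (l : Fin d) : ℝ :=
  posterior μ S (fun x => x i k * x j l) y
    - posterior μ S (fun x => x i k) y * posterior μ S (fun x => x j l) y

/-- The `d² × d²` matrix `Ψ_n(y)`, with entry `⟨C_{ik}, C_{jl}⟩ / n` in row `(i, j)` and column
`(k, l)`, where `C_{kl}` is the `n × n` matrix of the posterior covariances between the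
`k`-th and the `l`-th column of the signal. -/
def condCovGram (μ : Measure (Sig n d)) (S : Matrix (Fin d) (Fin d) ℝ) (y : Sig n d) :
    Matrix (Fin d × Fin d) (Fin d × Fin d) ℝ :=
  Matrix.of fun p q =>
    (1 / (n : ℝ)) * ∑ a : Fin n, ∑ b : Fin n,
      postCov μ S y a p.1 b q.1 * postCov μ S y a p.2 b q.2

/-- The entrywise expectation `E[Ψ_n(H_S)]`. -/
def meanCondCovGram (μ : Measure (Sig n d)) (S : Matrix (Fin d) (Fin d) ℝ) :
    Matrix (Fin d × Fin d) (Fin d × Fin d) ℝ :=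
  Matrix.of fun p q => ∫ y, condCovGram μ S y p q ∂(channelLaw μ S)

/-- Weak row-correlation of a sequence of priors: for each SNR matrix the Bayes-optimal denoisers
are Lipschitz with a constant that does not depend on `n`, and the operator norms of the
matrices `E[Ψ_n(H_S)]`, whose entries are finite, are bounded. -/
def WeakCorrelation (μ : (n : ℕ) → Measure (Sig n d)) : Prop :=
  (∀ S : Matrix (Fin d) (Fin d) ℝ, S.PosSemidef → ∃ L : ℝ, ∀ (n : ℕ) (y y' : Sig n d),
    √(frobSq (denoiser (μ n) S y - denoiser (μ n) S y')) ≤ L * √(frobSq (y - y'))) ∧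
  ∃ B : ℝ, ∀ (n : ℕ) (S : Matrix (Fin d) (Fin d) ℝ), S.PosSemidef →
    (∀ p q, Integrable (fun y => condCovGram (μ n) S y p q) (channelLaw (μ n) S)) ∧
    ‖Matrix.toEuclideanCLM (𝕜 := ℝ) (meanCondCovGram (μ n) S)‖ ≤ B

/-- The overlap at size `n`: the `d × d` matrix `(1/n) E[E[X | H_S]ᵀ E[X | H_S]]`. -/
def overlapAt (μ : Measure (Sig n d)) (S : Matrix (Fin d) (Fin d) ℝ) :
    Matrix (Fin d) (Fin d) ℝ :=
  Matrix.of fun k l =>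
    (1 / (n : ℝ)) * ∫ y, ∑ i, denoiser μ S y i k * denoiser μ S y i l ∂(channelLaw μ S)

/-- The limiting overlap function `ψ(S)`. -/
def overlap (μ : (n : ℕ) → Measure (Sig n d)) (S : Matrix (Fin d) (Fin d) ℝ) :
    Matrix (Fin d) (Fin d) ℝ :=
  limUnder atTop fun n => overlapAt (μ n) S

/-- The prior sequence with i.i.d. rows of law `P`. -/
def iidPrior (P : Measure (Fin d → ℝ)) (n : ℕ) : Measure (Sig n d) :=
  Measure.pi fun _ => P

/-- The linear map `𝒯(Q) = ∑ₖ Λₖ Q Λₖ`. -/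
def coupling (Λ : Fin K → Matrix (Fin d) (Fin d) ℝ) (Q : Matrix (Fin d) (Fin d) ℝ) :
    Matrix (Fin d) (Fin d) ℝ :=
  ∑ k, Λ k * Q * Λ k

/-- The Frobenius inner product. -/
def frobInner (A B : Matrix (Fin d) (Fin d) ℝ) : ℝ := (A.transpose * B).trace

/-- `E[X Xᵀ]` for a random vector `X` of law `P`. -/
def secondMoment (P : Measure (Fin d → ℝ)) : Matrix (Fin d) (Fin d) ℝ :=
  Matrix.of fun i j => ∫ x, x i * x j ∂P

/-- The set of the `Q` with `0 ⪯ Q ⪯ E[X Xᵀ]`. -/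
def feasible (P : Measure (Fin d → ℝ)) : Set (Matrix (Fin d) (Fin d) ℝ) :=
  {Q | Q.PosSemidef ∧ (secondMoment P - Q).PosSemidef}

/-- The relative entropy `D_⋆(R)` of the law of `R^{1/2} X + Z` with respect to the law of `Z`,
for independent `X` of law `P` and `Z` standard Gaussian. -/
def relEntropy (P : Measure (Fin d → ℝ)) (R : Matrix (Fin d) (Fin d) ℝ) : ENNReal :=
  InformationTheory.klDiv
    ((P.prod (Measure.pi fun _ => gaussianReal 0 1)).map
      fun p => (CFC.sqrt R).mulVec p.1 + p.2)
    (Measure.pi fun _ => gaussianReal 0 1)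

/-- The function of `Q` that the variational formula maximizes. It may take the value `-∞`. -/
def potential (P : Measure (Fin d → ℝ)) (Λ : Fin K → Matrix (Fin d) (Fin d) ℝ)
    (Q : Matrix (Fin d) (Fin d) ℝ) : EReal :=
  ⨅ (R : Matrix (Fin d) (Fin d) ℝ) (_ : R.PosSemidef),
    ((relEntropy P R : ENNReal) : EReal)
      + ((frobInner (coupling Λ Q) Q / 4 - frobInner R Q / 2 : ℝ) : EReal)

end MTP

end

open MeasureTheory ProbabilityTheory Filter Topology
open scoped MatrixOrder

noncomputable section

namespace MTP

/-! Write `W(S)` for the overlap of the channel with a single row (`rowOverlap`) and `D` for the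
relative entropy. With independent rows, Bayes' formula factorizes and the overlap at every size `n
≥ 1` equals `W(S)`, so `ψ = W`. The rest rests on one inequality (`entropy_add_frobInner_le`): `D(R)
≥ D(S) + ½⟨R - S, W(S)⟩`, so `D` is convex and `W/2` is a subgradient.

Let `Q` maximize the potential, `S = 𝒯(Q)` and `W = W(S)`, which is feasible. By the inequality, the
infimum that defines the potential at `W` is attained at `R = S`. Comparing it with any trial `R` in
the potential at `Q` and completing the square gives `D(S) + ½⟨R - S, Q⟩ + ¼⟨𝒯(W - Q), W - Q⟩ ≤
D(R)`. At `R = S` the quadratic term is at most zero. A convex quadratic form is nonnegative, so its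
null vectors are in the kernel of its operator, and `𝒯(W - Q) = 0`.

Now `Q/2` is also a subgradient of `D` at `S`. Monotonicity of subgradients along `S + t vvᵀ` and
upper semicontinuity of `W` as `t → 0` give `Q ⪯ W`. A positive semidefinite matrix killed by `𝒯`
vanishes when the `Λₖ` have no common kernel vector, hence `Q = W`.

The subgradient inequality is proved by rotating one channel into the other: the observation `(cos t
· S^{1/2}X + Z, sin t · R^{1/2}X + Z')` has linear SNR `cos² t · S + sin² t · R`, and no matrix
square root is ever differentiated. Gaussian integration by parts shows that the derivative of the
entropy is `sin t cos t` times a signed energy, and that this energy increases with `t` because the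
Hadamard square of a covariance matrix is positive semidefinite (`sum_sq_cov_nonneg`,
`entropy_path_le`). Bounded signals come first; truncation gives finite second moments. -/

/-- The standard Gaussian measure on `ℝ^J`. -/
abbrev stdGauss (J : Type*) [Fintype J] : Measure (J → ℝ) :=
  Measure.pi fun _ => gaussianReal 0 1

/-! ### Gaussian integration by parts and differentiation of Gaussian expectations -/

section Gaussian

variable {J : Type*} [Fintype J]

lemma integrable_exp_mul_abs_gaussianReal (a : ℝ) :
    Integrable (fun s : ℝ => Real.exp (a * |s|)) (gaussianReal 0 1) := by
  refine Integrable.mono' ((integrable_exp_mul_gaussianReal (μ := 0) (v := 1) a).add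
    (integrable_exp_mul_gaussianReal (μ := 0) (v := 1) (-a))) (by fun_prop) (ae_of_all _ fun s => ?_)
  rw [Real.norm_of_nonneg (Real.exp_pos _).le, Pi.add_apply]
  rcases abs_choice s with h | h <;> rw [h]
  · linarith [Real.exp_pos (-a * s)]
  · rw [mul_neg, ← neg_mul]; linarith [Real.exp_pos (a * s)]

lemma integrable_exp_mul_sum_abs (a : ℝ) :
    Integrable (fun z : J → ℝ => Real.exp (a * ∑ j, |z j|)) (stdGauss J) := by
  have := Integrable.fintype_prod (f := fun (_ : J) (s : ℝ) => Real.exp (a * |s|))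
    (μ := fun _ => gaussianReal 0 1) (fun _ => integrable_exp_mul_abs_gaussianReal a)
  simpa only [← Real.exp_sum, ← Finset.mul_sum] using this

/-- Gaussian integration by parts in one dimension. -/
lemma integral_id_mul_gaussianReal {h h' : ℝ → ℝ} (hd : ∀ s, HasDerivAt h (h' s) s)
    (h0 : Integrable h (gaussianReal 0 1)) (h1 : Integrable (fun s => s * h s) (gaussianReal 0 1))
    (h2 : Integrable h' (gaussianReal 0 1)) :
    ∫ s, s * h s ∂gaussianReal 0 1 = ∫ s, h' s ∂gaussianReal 0 1 := by
  have hpdf : ∀ s, HasDerivAt (gaussianPDFReal 0 1) (-s * gaussianPDFReal 0 1 s) s := by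
    intro s
    simp only [gaussianPDFReal_def]
    have := (((hasDerivAt_id s).sub_const 0).pow 2).neg.div_const (2 * ((1 : NNReal) : ℝ))
    refine (this.exp.const_mul _).congr_deriv ?_
    simp
    ring
  have key : ∀ f : ℝ → ℝ, Integrable f (gaussianReal 0 1) →
      Integrable (fun s => f s * gaussianPDFReal 0 1 s) := by
    intro f hf
    rw [gaussianReal_of_var_ne_zero _ one_ne_zero, integrable_withDensity_iff (by fun_prop)
      (ae_of_all _ fun _ => gaussianPDF_lt_top)] at hf
    simpa using hf
  rw [integral_gaussianReal_eq_integral_smul one_ne_zero,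
    integral_gaussianReal_eq_integral_smul one_ne_zero]
  have := integral_mul_deriv_eq_deriv_mul_of_integrable (u := h) (v := gaussianPDFReal 0 1)
    (u' := h') (v' := fun s => -s * gaussianPDFReal 0 1 s) (fun s _ => hd s) (fun s _ => hpdf s)
    (by refine (key _ h1).neg.congr (ae_of_all _ fun s => ?_)
        simp only [Pi.neg_apply, Pi.mul_apply]; ring)
    (key _ h2) (key _ h0)
  simp only [smul_eq_mul]
  have e1 : ∀ s, gaussianPDFReal 0 1 s * (s * h s) = -(h s * (-s * gaussianPDFReal 0 1 s)) :=
    fun s => by ring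
  simp only [e1, integral_neg, this, neg_neg]
  exact integral_congr_ae (ae_of_all _ fun s => by simp only []; ring)

/-- Resampling one coordinate does not change the Gaussian law. By Fubini this reduces integration
by parts in a coordinate to the one-dimensional case. -/
lemma measurePreserving_update [DecidableEq J] (j : J) :
    MeasurePreserving (fun p : (J → ℝ) × ℝ => Function.update p.1 j p.2)
      ((stdGauss J).prod (gaussianReal 0 1)) (stdGauss J) := by
  have hm : Measurable (fun p : (J → ℝ) × ℝ => Function.update p.1 j p.2) := by
    refine measurable_pi_lambda _ fun k => ?_
    by_cases hk : k = j
    · subst hk; simpa using measurable_snd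
    · simp only [Function.update_of_ne hk]
      exact (measurable_pi_apply k).comp measurable_fst
  refine ⟨hm, (Measure.pi_eq fun s hs => ?_).symm⟩
  rw [Measure.map_apply hm (MeasurableSet.univ_pi hs)]
  have : (fun p : (J → ℝ) × ℝ => Function.update p.1 j p.2) ⁻¹' (Set.univ.pi s)
      = (Set.univ.pi (Function.update s j Set.univ)) ×ˢ (s j) := by
    ext p
    simp only [Set.mem_preimage, Set.mem_pi, Set.mem_univ, true_implies, Set.mem_prod]
    constructor
    · intro h
      refine ⟨fun k => ?_, by simpa using h j⟩
      by_cases hk : k = j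
      · subst hk; simp
      · simpa [Function.update_of_ne hk] using h k
    · rintro ⟨h1, h2⟩ k
      by_cases hk : k = j
      · subst hk; simpa using h2
      · simpa [Function.update_of_ne hk] using h1 k
  rw [this, Measure.prod_prod, Measure.pi_pi, ← Finset.mul_prod_erase _ _ (Finset.mem_univ j),
    ← Finset.mul_prod_erase (a := j) Finset.univ (fun i => gaussianReal 0 1 (s i))
      (Finset.mem_univ j)]
  simp only [Function.update_self, measure_univ, one_mul]
  rw [mul_comm]
  congr 1
  refine Finset.prod_congr rfl fun k hk => ?_
  rw [Function.update_of_ne (Finset.ne_of_mem_erase hk)]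

/-- Uniform exponential growth of a family of functions on `ℝ^J`. -/
def ExpBdd {T : Type*} (f : T → (J → ℝ) → ℝ) : Prop :=
  ∃ C a : ℝ, 0 ≤ C ∧ 0 ≤ a ∧ ∀ t z, |f t z| ≤ C * Real.exp (a * ∑ j, |z j|)

namespace ExpBdd

variable {T : Type*} {f g : T → (J → ℝ) → ℝ}

lemma mono (hg : ExpBdd g) (h : ∀ t z, |f t z| ≤ |g t z|) : ExpBdd f := by
  obtain ⟨C, a, hC, ha, H⟩ := hg
  exact ⟨C, a, hC, ha, fun t z => (h t z).trans (H t z)⟩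

lemma const (c : ℝ) : ExpBdd (fun (_ : T) (_ : J → ℝ) => c) :=
  ⟨|c|, 0, abs_nonneg _, le_rfl, by simp⟩

lemma of_bdd {c : T → ℝ} {M : ℝ} (hc : ∀ t, |c t| ≤ M) :
    ExpBdd (fun (t : T) (_ : J → ℝ) => c t) :=
  (const M).mono fun t _ => (hc t).trans (le_abs_self _)

lemma coord (j : J) : ExpBdd (fun (_ : T) (z : J → ℝ) => z j) := by
  refine ⟨1, 1, zero_le_one, zero_le_one, fun _ z => ?_⟩
  rw [one_mul, one_mul]
  have : |z j| ≤ ∑ j, |z j| :=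
    Finset.single_le_sum (f := fun j => |z j|) (fun i _ => abs_nonneg _) (Finset.mem_univ j)
  linarith [Real.add_one_le_exp (∑ j, |z j|)]

lemma add (hf : ExpBdd f) (hg : ExpBdd g) : ExpBdd (fun t z => f t z + g t z) := by
  obtain ⟨C, a, hC, ha, H⟩ := hf
  obtain ⟨C', a', hC', ha', H'⟩ := hg
  refine ⟨C + C', a + a', by positivity, by positivity, fun t z => (abs_add_le _ _).trans ?_⟩
  have hN : 0 ≤ ∑ j, |z j| := Finset.sum_nonneg fun _ _ => abs_nonneg _
  rw [add_mul]
  refine add_le_add ((H t z).trans ?_) ((H' t z).trans ?_) <;> gcongr <;> linarith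

lemma mul (hf : ExpBdd f) (hg : ExpBdd g) : ExpBdd (fun t z => f t z * g t z) := by
  obtain ⟨C, a, hC, ha, H⟩ := hf
  obtain ⟨C', a', hC', ha', H'⟩ := hg
  refine ⟨C * C', a + a', by positivity, by positivity, fun t z => ?_⟩
  rw [abs_mul, add_mul, Real.exp_add]
  calc |f t z| * |g t z| ≤ _ := mul_le_mul (H t z) (H' t z) (abs_nonneg _) (by positivity)
    _ = _ := by ring

lemma neg (hf : ExpBdd f) : ExpBdd (fun t z => -f t z) := hf.mono fun t z => by simp

lemma sub (hf : ExpBdd f) (hg : ExpBdd g) : ExpBdd (fun t z => f t z - g t z) := by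
  simpa only [sub_eq_add_neg] using hf.add hg.neg

lemma pow (hf : ExpBdd f) (n : ℕ) : ExpBdd (fun t z => f t z ^ n) := by
  induction n with
  | zero => simpa using const 1
  | succ n ih => simpa only [pow_succ] using ih.mul hf

lemma sum {ι : Type*} {s : Finset ι} {f : ι → T → (J → ℝ) → ℝ} (h : ∀ i ∈ s, ExpBdd (f i)) :
    ExpBdd (fun t z => ∑ i ∈ s, f i t z) := by
  classical
  induction s using Finset.induction_on with
  | empty => simpa using const 0
  | insert i s hi ih =>
    simp only [Finset.sum_insert hi]
    exact (h i (Finset.mem_insert_self _ _)).add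
      (ih fun k hk => h k (Finset.mem_insert_of_mem hk))

lemma integrable (hf : ExpBdd f) (t : T) (hm : Measurable (f t)) :
    Integrable (f t) (stdGauss J) := by
  obtain ⟨C, a, hC, ha, H⟩ := hf
  exact ((integrable_exp_mul_sum_abs a).const_mul C).mono' hm.aestronglyMeasurable
    (ae_of_all _ fun z => H t z)

end ExpBdd

/-- Gaussian integration by parts in the coordinate `j`. -/
lemma integral_coord_mul_stdGauss [DecidableEq J] {h h' : (J → ℝ) → ℝ} (j : J)
    (hm : Measurable h) (hm' : Measurable h')
    (hb : ExpBdd (fun _ : Unit => h)) (hb' : ExpBdd (fun _ : Unit => h'))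
    (hd : ∀ z, HasDerivAt (fun s => h (Function.update z j s)) (h' z) (z j)) :
    ∫ z, z j * h z ∂stdGauss J = ∫ z, h' z ∂stdGauss J := by
  have hcm : Measurable fun z : J → ℝ => z j * h z := (measurable_pi_apply j).mul hm
  have hcb : ExpBdd (fun (_ : Unit) z => z j * h z) := (ExpBdd.coord j).mul hb
  have hI : ∀ f : (J → ℝ) → ℝ, Measurable f → ExpBdd (fun _ : Unit => f) →
      Integrable (fun p : (J → ℝ) × ℝ => f (Function.update p.1 j p.2))
        ((stdGauss J).prod (gaussianReal 0 1)) := fun f hf hfb =>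
    (measurePreserving_update j).integrable_comp_of_integrable (hfb.integrable () hf)
  have hE : ∀ f : (J → ℝ) → ℝ, Measurable f → ExpBdd (fun _ : Unit => f) →
      ∫ z, f z ∂stdGauss J
        = ∫ z, ∫ s, f (Function.update z j s) ∂gaussianReal 0 1 ∂stdGauss J := by
    intro f hf hfb
    rw [← integral_prod _ (hI f hf hfb), ← (measurePreserving_update j).map_eq,
      integral_map (measurePreserving_update j).measurable.aemeasurable
        hf.aestronglyMeasurable, (measurePreserving_update j).map_eq]
  rw [hE _ hcm hcb, hE _ hm' hb']
  refine integral_congr_ae ?_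
  filter_upwards [(hI _ hcm hcb).prod_right_ae, (hI _ hm hb).prod_right_ae,
    (hI _ hm' hb').prod_right_ae] with z h1 h2 h3
  simp only [Function.update_self] at h1 ⊢
  refine integral_id_mul_gaussianReal (fun s => ?_) h2 h1 h3
  simpa using hd (Function.update z j s)

/-- Differentiation of Gaussian expectations along a path: if the time derivative of `f` is
`∑ⱼ cⱼ' (zⱼ Aⱼ - cⱼ Bⱼ)` and `∂ⱼ Aⱼ = cⱼ (Bⱼ + Dⱼ)`, then that of its expectation is
`∑ⱼ cⱼ cⱼ' E[Dⱼ]`. -/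
lemma hasDerivAt_integral_stdGauss [DecidableEq J] {c c' : J → ℝ → ℝ}
    {f : ℝ → (J → ℝ) → ℝ} {A B D : J → ℝ → (J → ℝ) → ℝ}
    (hc : ∀ j t, |c j t| ≤ 1) (hc' : ∀ j t, |c' j t| ≤ 1)
    (hfm : ∀ t, Measurable (f t)) (hAm : ∀ j t, Measurable (A j t))
    (hBm : ∀ j t, Measurable (B j t)) (hDm : ∀ j t, Measurable (D j t))
    (hfb : ExpBdd f) (hAb : ∀ j, ExpBdd (A j)) (hBb : ∀ j, ExpBdd (B j)) (hDb : ∀ j, ExpBdd (D j))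
    (hf : ∀ t z, HasDerivAt (fun t => f t z) (∑ j, c' j t * (z j * A j t z - c j t * B j t z)) t)
    (hA : ∀ j t z, HasDerivAt (fun s => A j t (Function.update z j s))
      (c j t * (B j t z + D j t z)) (z j)) (t : ℝ) :
    HasDerivAt (fun t => ∫ z, f t z ∂stdGauss J) (∑ j, c j t * c' j t * ∫ z, D j t z ∂stdGauss J)
      t := by
  have hb1 : ∀ j, ExpBdd (fun t z => c' j t * (z j * A j t z - c j t * B j t z)) := fun j =>
    (ExpBdd.of_bdd (hc' j)).mul
      (((ExpBdd.coord j).mul (hAb j)).sub ((ExpBdd.of_bdd (hc j)).mul (hBb j)))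
  have hzm : ∀ j t, Measurable fun z : J → ℝ => z j * A j t z := fun j t =>
    (measurable_pi_apply j).mul (hAm j t)
  have hm1 : ∀ j t, Measurable (fun z : J → ℝ => c' j t * (z j * A j t z - c j t * B j t z)) :=
    fun j t => ((hzm j t).sub ((hBm j t).const_mul _)).const_mul _
  have hbs := ExpBdd.sum (s := Finset.univ) fun j _ => hb1 j
  have hb2 := hbs
  obtain ⟨C, a, hC, ha, H⟩ := hb2
  -- The growth bound is uniform in `t`, so a single dominating function serves on the whole line.
  have key := (hasDerivAt_integral_of_dominated_loc_of_deriv_le (μ := stdGauss J) (F := f)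
    (F' := fun t z => ∑ j, c' j t * (z j * A j t z - c j t * B j t z))
    (bound := fun z => C * Real.exp (a * ∑ j, |z j|)) (x₀ := t) (s := Set.univ) univ_mem
    (Eventually.of_forall fun t => (hfm t).aestronglyMeasurable) (hfb.integrable t (hfm t))
    (Finset.measurable_sum _ fun j _ => hm1 j t).aestronglyMeasurable
    (ae_of_all _ fun z s _ => H s z) ((integrable_exp_mul_sum_abs a).const_mul C)
    (ae_of_all _ fun z s _ => hf s z)).2
  refine key.congr_deriv ?_
  rw [integral_finsetSum _ fun j _ => (hb1 j).integrable t (hm1 j t)]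
  refine Finset.sum_congr rfl fun j _ => ?_
  have hAi : Integrable (fun z : J → ℝ => z j * A j t z) (stdGauss J) :=
    ((ExpBdd.coord j).mul (hAb j)).integrable t (hzm j t)
  have hBi := (hBb j).integrable t (hBm j t)
  have hDi := (hDb j).integrable t (hDm j t)
  have hr : ∀ {f : ℝ → (J → ℝ) → ℝ}, ExpBdd f → ExpBdd (fun _ : Unit => f t) := fun hf => by
    obtain ⟨C, a, hC, ha, H⟩ := hf
    exact ⟨C, a, hC, ha, fun _ => H t⟩
  rw [integral_const_mul, integral_sub hAi (hBi.const_mul _),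
    integral_coord_mul_stdGauss j (hAm j t) (((hBm j t).add (hDm j t)).const_mul (c j t)) (hr (hAb j))
      ((ExpBdd.const (c j t)).mul ((hr (hBb j)).add (hr (hDb j)))) (hA j t)]
  simp only [Pi.add_apply, integral_const_mul]
  rw [integral_add hBi hDi]
  ring

end Gaussian

/-! ### Exponential moments of bounded statistics -/

section ExpMoment

variable {X I : Type*} [Fintype I] {φ : I → X → ℝ}

lemma abs_sum_mul_le {β : ℝ} (hβ : ∀ i x, |φ i x| ≤ β) (y : I → ℝ) (x : X) :
    |∑ i, y i * φ i x| ≤ β * ∑ i, |y i| := by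
  rw [Finset.mul_sum]
  refine (Finset.abs_sum_le_sum_abs _ _).trans (Finset.sum_le_sum fun i _ => ?_)
  rw [abs_mul, mul_comm]
  exact mul_le_mul_of_nonneg_right (hβ i x) (abs_nonneg _)

variable [MeasurableSpace X] {ν : Measure X}

/-- Bounded measurable real functions. -/
def BddMeas (h : X → ℝ) : Prop := Measurable h ∧ ∃ M, ∀ x, |h x| ≤ M

namespace BddMeas

variable {h k : X → ℝ}

lemma const (c : ℝ) : BddMeas (fun _ : X => c) := ⟨measurable_const, |c|, fun _ => le_rfl⟩

lemma mul (hh : BddMeas h) (hk : BddMeas k) : BddMeas (fun x => h x * k x) := by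
  obtain ⟨hm, M, hM⟩ := hh
  obtain ⟨km, M', hM'⟩ := hk
  refine ⟨hm.mul km, M * M', fun x => ?_⟩
  rw [abs_mul]
  exact mul_le_mul (hM x) (hM' x) (abs_nonneg _) ((abs_nonneg _).trans (hM x))

lemma pow (hh : BddMeas h) (n : ℕ) : BddMeas (fun x => h x ^ n) := by
  induction n with
  | zero => simpa using const 1
  | succ n ih => simpa only [pow_succ] using ih.mul hh

lemma sum {ι : Type*} {s : Finset ι} {f : ι → X → ℝ} (hf : ∀ i, BddMeas (f i)) :
    BddMeas (fun x => ∑ i ∈ s, f i x) := by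
  refine ⟨Finset.measurable_fun_sum _ fun i _ => (hf i).1, ∑ i ∈ s, (hf i).2.choose, fun x => ?_⟩
  exact (Finset.abs_sum_le_sum_abs _ _).trans
    (Finset.sum_le_sum fun i _ => (hf i).2.choose_spec x)

lemma integrable [IsFiniteMeasure ν] (hh : BddMeas h) : Integrable h ν := by
  obtain ⟨hm, M, hM⟩ := hh
  exact (integrable_const M).mono' hm.aestronglyMeasurable (ae_of_all _ fun x => hM x)

lemma exists_forall_abs_le (hφ : ∀ i, BddMeas (φ i)) : ∃ β, 0 ≤ β ∧ ∀ i x, |φ i x| ≤ β := by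
  refine ⟨∑ i, |(hφ i).2.choose|, Finset.sum_nonneg fun _ _ => abs_nonneg _, fun i x => ?_⟩
  exact ((hφ i).2.choose_spec x).trans ((le_abs_self _).trans
    (Finset.single_le_sum (f := fun i => |(hφ i).2.choose|) (fun i _ => abs_nonneg _)
      (Finset.mem_univ i)))

end BddMeas

/-- The exponential moment `∫ h exp(∑ᵢ yᵢ φᵢ) dν`. -/
def expMoment (ν : Measure X) (φ : I → X → ℝ) (h : X → ℝ) (y : I → ℝ) : ℝ :=
  ∫ x, h x * Real.exp (∑ i, y i * φ i x) ∂ν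

lemma measurable_expWeight (hφ : ∀ i, BddMeas (φ i)) (y : I → ℝ) :
    Measurable fun x => Real.exp (∑ i, y i * φ i x) :=
  (Finset.measurable_fun_sum _ fun i _ => ((hφ i).1.const_mul _)).exp

lemma BddMeas.expWeight (hφ : ∀ i, BddMeas (φ i)) (y : I → ℝ) :
    BddMeas fun x => Real.exp (∑ i, y i * φ i x) := by
  obtain ⟨β, hβ0, hβ⟩ := BddMeas.exists_forall_abs_le hφ
  refine ⟨measurable_expWeight hφ y, Real.exp (β * ∑ i, |y i|), fun x => ?_⟩
  rw [abs_of_pos (Real.exp_pos _)]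
  exact Real.exp_le_exp.2 ((le_abs_self _).trans (abs_sum_mul_le hβ y x))

variable [IsFiniteMeasure ν]

/-- Differentiation under the integral: bounded statistics give a uniform bound on the unit ball
around `y`. The derivative is described by its values, which are again exponential moments, so that
the rule can be iterated. -/
lemma hasFDerivAt_expMoment (hφ : ∀ i, BddMeas (φ i)) {h : X → ℝ} (hh : BddMeas h) (y : I → ℝ) :
    ∃ L : (I → ℝ) →L[ℝ] ℝ, HasFDerivAt (expMoment ν φ h) L y ∧
      ∀ v, L v = ∑ i, v i * expMoment ν φ (fun x => h x * φ i x) y := by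
  obtain ⟨β, hβ0, hβ⟩ := BddMeas.exists_forall_abs_le hφ
  obtain ⟨hm, M, hM⟩ := id hh
  obtain ⟨A, N, hA, hAm, hAb⟩ : ∃ (A : X → (I → ℝ) →L[ℝ] ℝ) (N : ℝ),
      (∀ x v, A x v = ∑ i, v i * φ i x) ∧ StronglyMeasurable A ∧ ∀ x, ‖A x‖ ≤ N := by
    refine ⟨fun x => ∑ i, φ i x • ContinuousLinearMap.proj i,
      ∑ i : I, β * ‖(ContinuousLinearMap.proj i : (I → ℝ) →L[ℝ] ℝ)‖, fun x v => by simp [mul_comm],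
      Finset.stronglyMeasurable_fun_sum _ fun i _ => (hφ i).1.stronglyMeasurable.smul_const _,
      fun x => (norm_sum_le _ _).trans (Finset.sum_le_sum fun i _ => ?_)⟩
    rw [norm_smul]
    exact mul_le_mul_of_nonneg_right (hβ i x) (norm_nonneg _)
  obtain ⟨F', hF'⟩ : ∃ F' : (I → ℝ) → X → (I → ℝ) →L[ℝ] ℝ,
      ∀ y x, F' y x = (h x * Real.exp (∑ i, y i * φ i x)) • A x := ⟨_, fun _ _ => rfl⟩
  have hF'm : AEStronglyMeasurable (F' y) ν := by
    rw [show F' y = _ from funext (hF' y)]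
    exact ((hm.mul (measurable_expWeight hφ y)).stronglyMeasurable.smul hAm).aestronglyMeasurable
  have hbound : ∀ x, ∀ w ∈ Metric.ball y 1, ‖F' w x‖ ≤ M * Real.exp (β * ∑ i, (|y i| + 1)) * N := by
    intro x w hw
    rw [hF', norm_smul, norm_mul, Real.norm_of_nonneg (Real.exp_pos _).le]
    have hM0 : 0 ≤ M := (abs_nonneg _).trans (hM x)
    refine mul_le_mul (mul_le_mul (hM x) ?_ (Real.exp_pos _).le hM0) (hAb x) (norm_nonneg _)
      (by positivity)
    refine Real.exp_le_exp.2 ((le_abs_self _).trans ((abs_sum_mul_le hβ w x).trans ?_))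
    refine mul_le_mul_of_nonneg_left (Finset.sum_le_sum fun i _ => ?_) hβ0
    have h1 : |w i - y i| ≤ 1 :=
      (norm_le_pi_norm (w - y) i).trans (by rw [← dist_eq_norm]; exact (Metric.mem_ball.1 hw).le)
    have h2 := abs_sub_abs_le_abs_sub (w i) (y i)
    linarith
  have hint : Integrable (F' y) ν :=
    (integrable_const _).mono' hF'm
      (ae_of_all _ fun x => hbound x y (Metric.mem_ball_self one_pos))
  refine ⟨∫ x, F' y x ∂ν, ?_, fun v => ?_⟩
  · have hm1 : ∀ w : I → ℝ, AEStronglyMeasurable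
        (fun x => h x * Real.exp (∑ i, w i * φ i x)) ν := fun w =>
      (hm.mul (measurable_expWeight hφ w)).aestronglyMeasurable
    have hi1 : Integrable (fun x => h x * Real.exp (∑ i, y i * φ i x)) ν :=
      (hh.mul (BddMeas.expWeight hφ y)).integrable
    have hd : ∀ x w, HasFDerivAt (fun y : I → ℝ => h x * Real.exp (∑ i, y i * φ i x)) (F' w x)
        w := by
      intro x w
      have h1 : HasFDerivAt (fun y : I → ℝ => ∑ i, y i * φ i x) (A x) w := by
        have : (fun y : I → ℝ => ∑ i, y i * φ i x) = A x := by ext v; rw [hA]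
        rw [this]
        exact (A x).hasFDerivAt
      have h2 := (h1.exp).const_mul (h x)
      rwa [smul_smul, ← hF'] at h2
    exact hasFDerivAt_integral_of_dominated_of_fderiv_le (Metric.ball_mem_nhds y one_pos)
      (Eventually.of_forall hm1) hi1 hF'm (ae_of_all _ hbound)
      (integrable_const _) (ae_of_all _ fun x w _ => hd x w)
  · rw [ContinuousLinearMap.integral_apply hint]
    simp only [hF', smul_apply, hA, smul_eq_mul, Finset.mul_sum, expMoment,
      ← integral_const_mul]
    rw [integral_finsetSum]
    · exact Finset.sum_congr rfl fun i _ => integral_congr_ae (ae_of_all _ fun x => by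
        simp only []; ring)
    · intro i _
      exact ((hh.mul (BddMeas.expWeight hφ y)).mul ((BddMeas.const (v i)).mul (hφ i))).integrable

lemma continuous_expMoment (hφ : ∀ i, BddMeas (φ i)) {h : X → ℝ} (hh : BddMeas h) :
    Continuous (expMoment ν φ h) :=
  continuous_iff_continuousAt.2 fun y =>
    (hasFDerivAt_expMoment hφ hh y).choose_spec.1.continuousAt

lemma hasDerivAt_expMoment_comp (hφ : ∀ i, BddMeas (φ i)) {h : X → ℝ} (hh : BddMeas h)
    {y : ℝ → I → ℝ} {y' : I → ℝ} {s : ℝ} (hy : ∀ i, HasDerivAt (fun s => y s i) (y' i) s) :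
    HasDerivAt (fun s => expMoment ν φ h (y s))
      (∑ i, y' i * expMoment ν φ (fun x => h x * φ i x) (y s)) s := by
  obtain ⟨L, hL, hLv⟩ := hasFDerivAt_expMoment (ν := ν) hφ hh (y s)
  rw [← hLv]
  exact hL.comp_hasDerivAt s (hasDerivAt_pi.2 hy)

lemma abs_expMoment_le {β M : ℝ} (hβ : ∀ i x, |φ i x| ≤ β) {h : X → ℝ}
    (hM : ∀ x, |h x| ≤ M) (y : I → ℝ) :
    |expMoment ν φ h y| ≤ ν.real Set.univ * (M * Real.exp (β * ∑ i, |y i|)) := by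
  have := norm_integral_le_of_norm_le_const (μ := ν) (C := M * Real.exp (β * ∑ i, |y i|))
    (f := fun x => h x * Real.exp (∑ i, y i * φ i x)) (ae_of_all _ fun x => ?_)
  · rwa [mul_comm] at this
  · rw [norm_mul, Real.norm_of_nonneg (Real.exp_pos _).le]
    exact mul_le_mul (hM x) (Real.exp_le_exp.2 ((le_abs_self _).trans (abs_sum_mul_le hβ y x)))
      (Real.exp_pos _).le ((abs_nonneg _).trans (hM x))

/-- The normalization appears in denominators and under a logarithm; this lower bound gives its
inverse exponential growth at most. -/
lemma le_expMoment_one {β : ℝ} (hφ : ∀ i, BddMeas (φ i)) (hβ : ∀ i x, |φ i x| ≤ β) (y : I → ℝ) :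
    ν.real Set.univ * Real.exp (-(β * ∑ i, |y i|)) ≤ expMoment ν φ (fun _ => 1) y := by
  rw [← smul_eq_mul, ← integral_const, expMoment]
  refine integral_mono (integrable_const _)
    ((BddMeas.const 1).mul (BddMeas.expWeight hφ y)).integrable fun x => ?_
  simp only [one_mul]
  exact Real.exp_le_exp.2 (neg_le.1 ((neg_le_abs _).trans (abs_sum_mul_le hβ y x)))

/-- Cauchy-Schwarz for a weighted mean. -/
lemma sq_integral_mul_div_le {ν : Measure X} {h w : X → ℝ} (hw0 : ∀ x, 0 ≤ w x)
    (hw : Integrable w ν) (hhw : Integrable (fun x => h x * w x) ν)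
    (hhhw : Integrable (fun x => h x ^ 2 * w x) ν) :
    (∫ x, h x * w x ∂ν) ^ 2 / ∫ x, w x ∂ν ≤ ∫ x, h x ^ 2 * w x ∂ν := by
  set m := ∫ x, w x ∂ν
  set p := ∫ x, h x * w x ∂ν
  have hm0 : 0 ≤ m := integral_nonneg hw0
  rcases hm0.eq_or_lt with h0 | h0
  · rw [← h0, div_zero]
    exact integral_nonneg fun x => mul_nonneg (sq_nonneg _) (hw0 x)
  -- The weighted variance around the weighted mean `p / m`, expanded below.
  have key : 0 ≤ ∫ x, (h x - p / m) ^ 2 * w x ∂ν :=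
    integral_nonneg fun x => mul_nonneg (sq_nonneg _) (hw0 x)
  have e : ∀ x, (h x - p / m) ^ 2 * w x
      = h x ^ 2 * w x - 2 * (p / m) * (h x * w x) + (p / m) ^ 2 * w x := fun x => by ring
  simp only [e] at key
  rw [integral_add (f := fun x => h x ^ 2 * w x - 2 * (p / m) * (h x * w x))
      (hhhw.sub (hhw.const_mul _)) (hw.const_mul _),
    integral_sub hhhw (hhw.const_mul _), integral_const_mul, integral_const_mul] at key
  have e2 : 2 * (p / m) * p = 2 * (p ^ 2 / m) := by ring
  have e3 : (p / m) ^ 2 * m = p ^ 2 / m := by field_simp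
  change 0 ≤ _ - 2 * (p / m) * p + (p / m) ^ 2 * m at key
  rw [e2, e3] at key
  linarith

end ExpMoment

/-! ### Entropy and energy along a path of Gaussian channels -/

section PathMoment

variable {X J : Type*}

/-- The statistics `bⱼ, bⱼ²` of which the likelihood ratio is an exponential family. -/
def tiltFun (b : J → X → ℝ) : J ⊕ J → X → ℝ := Sum.elim b fun j x => b j x ^ 2

/-- The parameters `aⱼ zⱼ, -aⱼ²/2` of the likelihood ratio. -/
def tiltParam (a z : J → ℝ) : J ⊕ J → ℝ :=
  Sum.elim (fun j => a j * z j) fun j => -(a j ^ 2 / 2)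

lemma sum_tilt [Fintype J] (b : J → X → ℝ) (a z : J → ℝ) (x : X) :
    ∑ i, tiltParam a z i * tiltFun b i x = ∑ j, (a j * b j x * z j - (a j * b j x) ^ 2 / 2) := by
  rw [Fintype.sum_sum_type, ← Finset.sum_add_distrib]
  refine Finset.sum_congr rfl fun j _ => ?_
  simp only [tiltParam, tiltFun, Sum.elim_inl, Sum.elim_inr]
  ring

lemma continuous_tiltParam (a : J → ℝ) : Continuous (tiltParam a) := by
  refine continuous_pi fun i => ?_
  rcases i with j | j
  · exact continuous_const.mul (continuous_apply j)
  · exact continuous_const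

lemma sum_abs_tiltParam_le [Fintype J] {a : J → ℝ} (ha : ∀ j, |a j| ≤ 1) (z : J → ℝ) :
    ∑ i, |tiltParam a z i| ≤ ∑ j, |z j| + Fintype.card J := by
  rw [Fintype.sum_sum_type]
  refine add_le_add (Finset.sum_le_sum fun j _ => ?_) ?_
  · simp only [tiltParam, Sum.elim_inl, abs_mul]
    exact mul_le_of_le_one_left (abs_nonneg _) (ha j)
  · have : ∀ j ∈ (Finset.univ : Finset J), |tiltParam a z (Sum.inr j)| ≤ 1 := fun j _ => by
      simp only [tiltParam, Sum.elim_inr, abs_neg]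
      rw [abs_of_nonneg (by positivity)]
      have := (sq_le_one_iff_abs_le_one (a j)).2 (ha j)
      linarith
    simpa using Finset.sum_le_card_nsmul _ _ _ this

lemma BddMeas.tiltFun [MeasurableSpace X] {b : J → X → ℝ} (hb : ∀ j, BddMeas (b j)) :
    ∀ i, BddMeas (tiltFun b i) := by
  rintro (j | j)
  · exact hb j
  · exact (hb j).pow 2

variable [Fintype J] [MeasurableSpace X] (ν : Measure X) (b : J → X → ℝ) (c : J → ℝ → ℝ)

/-- The integral of `h` against the likelihood ratio of the channel with means `cⱼ(t) bⱼ`. -/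
def pathMoment (h : X → ℝ) (t : ℝ) (z : J → ℝ) : ℝ :=
  expMoment ν (tiltFun b) h (tiltParam (fun j => c j t) z)

variable {ν b c} {c' : J → ℝ → ℝ}

variable [IsFiniteMeasure ν]

lemma measurable_pathMoment (hb : ∀ j, BddMeas (b j)) {h : X → ℝ} (hh : BddMeas h) (t : ℝ) :
    Measurable (pathMoment ν b c h t) :=
  ((continuous_expMoment (BddMeas.tiltFun hb) hh).comp (continuous_tiltParam _)).measurable

lemma expBdd_pathMoment (hb : ∀ j, BddMeas (b j)) (hc : ∀ j t, |c j t| ≤ 1) {h : X → ℝ}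
    (hh : BddMeas h) : ExpBdd (pathMoment ν b c h) := by
  obtain ⟨β, hβ0, hβ⟩ := BddMeas.exists_forall_abs_le (BddMeas.tiltFun hb)
  obtain ⟨M, hM⟩ := hh.2
  refine ⟨ν.real Set.univ * (|M| * Real.exp (β * Fintype.card J)), β, by positivity, hβ0,
    fun t z => ?_⟩
  refine (abs_expMoment_le hβ (fun x => (hM x).trans (le_abs_self M)) _).trans ?_
  rw [mul_assoc, mul_assoc, ← Real.exp_add]
  have := mul_le_mul_of_nonneg_left (sum_abs_tiltParam_le (fun j => hc j t) z) hβ0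
  gcongr
  linarith

variable [NeZero ν]

lemma pathMoment_one_pos (hb : ∀ j, BddMeas (b j)) (t : ℝ) (z : J → ℝ) :
    0 < pathMoment ν b c (fun _ => 1) t z := by
  obtain ⟨β, hβ0, hβ⟩ := BddMeas.exists_forall_abs_le (BddMeas.tiltFun hb)
  have h0 : 0 < ν.real Set.univ := by
    rw [measureReal_def]
    exact ENNReal.toReal_pos (NeZero.ne _) (measure_ne_top _ _)
  exact lt_of_lt_of_le (by positivity) (le_expMoment_one (BddMeas.tiltFun hb) hβ _)

lemma expBdd_inv_pathMoment_one (hb : ∀ j, BddMeas (b j)) (hc : ∀ j t, |c j t| ≤ 1) :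
    ExpBdd (fun t z => (pathMoment ν b c (fun _ => 1) t z)⁻¹) := by
  obtain ⟨β, hβ0, hβ⟩ := BddMeas.exists_forall_abs_le (BddMeas.tiltFun hb)
  have h0 : 0 < ν.real Set.univ := by
    rw [measureReal_def]
    exact ENNReal.toReal_pos (NeZero.ne _) (measure_ne_top _ _)
  refine ⟨(ν.real Set.univ)⁻¹ * Real.exp (β * Fintype.card J), β, by positivity, hβ0,
    fun t z => ?_⟩
  rw [abs_of_pos (inv_pos.2 (pathMoment_one_pos hb t z))]
  refine (inv_anti₀ (by positivity) (le_expMoment_one (BddMeas.tiltFun hb) hβ _)).trans ?_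
  rw [mul_inv, ← Real.exp_neg, neg_neg, mul_assoc, ← Real.exp_add]
  have := mul_le_mul_of_nonneg_left (sum_abs_tiltParam_le (fun j => hc j t) z) hβ0
  gcongr
  linarith

lemma expBdd_log_pathMoment_one (hb : ∀ j, BddMeas (b j)) (hc : ∀ j t, |c j t| ≤ 1) :
    ExpBdd (fun t z => Real.log (pathMoment ν b c (fun _ => 1) t z)) := by
  refine ((expBdd_pathMoment (ν := ν) hb hc (BddMeas.const 1)).add
    (expBdd_inv_pathMoment_one (ν := ν) hb hc)).mono fun t z => ?_
  have h0 := pathMoment_one_pos (ν := ν) (c := c) hb t z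
  have h1 := inv_pos.2 h0
  rw [abs_of_pos (add_pos h0 h1), abs_le]
  -- `log u ≤ u - 1`, applied to the moment and to its inverse, bounds the logarithm on both sides.
  have h2 := Real.log_le_sub_one_of_pos h0
  have h3 := Real.log_le_sub_one_of_pos h1
  rw [Real.log_inv] at h3
  constructor <;> linarith

omit [NeZero ν] in
lemma hasDerivAt_pathMoment_time (hb : ∀ j, BddMeas (b j))
    (hc : ∀ j t, HasDerivAt (c j) (c' j t) t) {h : X → ℝ} (hh : BddMeas h) (t : ℝ) (z : J → ℝ) :
    HasDerivAt (fun t => pathMoment ν b c h t z)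
      (∑ j, c' j t * (z j * pathMoment ν b c (fun x => h x * b j x) t z
        - c j t * pathMoment ν b c (fun x => h x * b j x ^ 2) t z)) t := by
  have := hasDerivAt_expMoment_comp (ν := ν) (BddMeas.tiltFun hb) hh
    (y := fun t => tiltParam (fun j => c j t) z)
    (y' := Sum.elim (fun j => c' j t * z j) fun j => -(c j t * c' j t)) (s := t) ?_
  · refine this.congr_deriv ?_
    rw [Fintype.sum_sum_type, ← Finset.sum_add_distrib]
    refine Finset.sum_congr rfl fun j _ => ?_
    simp only [Sum.elim_inl, Sum.elim_inr, pathMoment, tiltFun]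
    ring
  · rintro (j | j)
    · exact (hc j t).mul_const _
    · refine (((hc j t).pow 2).div_const 2).neg.congr_deriv ?_
      simp only [Sum.elim_inr]
      push_cast
      ring

omit [NeZero ν] in
lemma hasDerivAt_pathMoment_space [DecidableEq J] (hb : ∀ j, BddMeas (b j)) {h : X → ℝ}
    (hh : BddMeas h) (j : J) (t : ℝ) (z : J → ℝ) :
    HasDerivAt (fun s => pathMoment ν b c h t (Function.update z j s))
      (c j t * pathMoment ν b c (fun x => h x * b j x) t z) (z j) := by
  have := hasDerivAt_expMoment_comp (ν := ν) (BddMeas.tiltFun hb) hh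
    (y := fun s => tiltParam (fun j => c j t) (Function.update z j s))
    (y' := Sum.elim (fun k => if k = j then c j t else 0) 0) (s := z j) ?_
  · refine this.congr_deriv ?_
    rw [Fintype.sum_sum_type]
    simp [pathMoment, tiltFun]
  · rintro (k | k)
    · simp only [tiltParam, Sum.elim_inl]
      by_cases hk : k = j
      · subst hk
        simpa using (hasDerivAt_id (z k)).const_mul (c k t)
      · simpa [hk] using hasDerivAt_const (z j) (c k t * z k)
    · exact hasDerivAt_const _ _

/-- The derivative of the relative entropy along a path of channels. -/
lemma hasDerivAt_entropy [DecidableEq J] (hb : ∀ j, BddMeas (b j)) (hc1 : ∀ j t, |c j t| ≤ 1)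
    (hc1' : ∀ j t, |c' j t| ≤ 1) (hc : ∀ j t, HasDerivAt (c j) (c' j t) t) (t : ℝ) :
    HasDerivAt
      (fun t => ∫ z, InformationTheory.klFun (pathMoment ν b c (fun _ => 1) t z) ∂stdGauss J)
      (∑ j, c j t * c' j t * ∫ z, pathMoment ν b c (b j) t z ^ 2 *
        (pathMoment ν b c (fun _ => 1) t z)⁻¹ ∂stdGauss J) t := by
  have h1 : BddMeas (fun _ : X => (1 : ℝ)) := BddMeas.const 1
  have hgm := fun t => measurable_pathMoment (ν := ν) (c := c) hb h1 t
  have hgb := expBdd_pathMoment (ν := ν) hb hc1 h1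
  have hlm := fun t => (hgm t).log
  have hlb := expBdd_log_pathMoment_one (ν := ν) hb hc1
  have hpm := fun j t => measurable_pathMoment (ν := ν) (c := c) hb (hb j) t
  have hpb := fun j => expBdd_pathMoment (ν := ν) hb hc1 (hb j)
  have hmm := fun j t => measurable_pathMoment (ν := ν) (c := c) hb ((hb j).pow 2) t
  have hmb := fun j => expBdd_pathMoment (ν := ν) hb hc1 ((hb j).pow 2)
  -- Let `g`, `pⱼ`, `mⱼ` be the moments of `1`, `bⱼ`, `bⱼ²`. As `klFun' = log`, the time derivative
  -- has `Aⱼ = pⱼ log g` and `Bⱼ = mⱼ log g`. Differentiating `Aⱼ` in `zⱼ` leaves the extra term `Dⱼ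
  -- = pⱼ²/g` from the logarithm.
  refine hasDerivAt_integral_stdGauss
    (D := fun j t z => pathMoment ν b c (b j) t z ^ 2 * (pathMoment ν b c (fun _ => 1) t z)⁻¹)
    (A := fun j t z => Real.log (pathMoment ν b c (fun _ => 1) t z) * pathMoment ν b c (b j) t z)
    (B := fun j t z => Real.log (pathMoment ν b c (fun _ => 1) t z) *
      pathMoment ν b c (fun x => b j x ^ 2) t z)
    hc1 hc1' (fun t => InformationTheory.measurable_klFun.comp (hgm t))
    (fun j t => (hlm t).mul (hpm j t)) (fun j t => (hlm t).mul (hmm j t))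
    (fun j t => ((hpm j t).pow_const 2).mul (hgm t).inv)
    (((hgb.mul hlb).add (ExpBdd.const 1)).sub hgb) (fun j => hlb.mul (hpb j))
    (fun j => hlb.mul (hmb j))
    (fun j => ((hpb j).pow 2).mul (expBdd_inv_pathMoment_one hb hc1)) (fun t z => ?_)
    (fun j t z => ?_) t
  · have h0 := (pathMoment_one_pos (ν := ν) (c := c) hb t z).ne'
    refine ((InformationTheory.hasDerivAt_klFun h0).comp t
      (hasDerivAt_pathMoment_time hb hc h1 t z)).congr_deriv ?_
    rw [Finset.mul_sum]
    simp only [one_mul]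
    exact Finset.sum_congr rfl fun j _ => by ring
  · have h0 := (pathMoment_one_pos (ν := ν) (c := c) hb t z).ne'
    have hg := hasDerivAt_pathMoment_space (ν := ν) (c := c) hb h1 j t z
    have hp := hasDerivAt_pathMoment_space (ν := ν) (c := c) hb (hb j) j t z
    refine ((hg.log (by simpa using h0)).mul hp).congr_deriv ?_
    simp only [one_mul, Function.update_eq_self, pow_two]
    ring

/-- The derivative of the signed energy along a path of channels. -/
lemma hasDerivAt_energy [DecidableEq J] (hb : ∀ j, BddMeas (b j)) (hc1 : ∀ j t, |c j t| ≤ 1)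
    (hc1' : ∀ j t, |c' j t| ≤ 1) (hc : ∀ j t, HasDerivAt (c j) (c' j t) t) (ε : J → ℝ) (t : ℝ) :
    HasDerivAt
      (fun t => ∫ z, ∑ k, ε k * (pathMoment ν b c (b k) t z ^ 2 *
        (pathMoment ν b c (fun _ => 1) t z)⁻¹) ∂stdGauss J)
      (∑ j, c j t * c' j t * ∫ z, ∑ k, ε k * (2 * (pathMoment ν b c (fun x => b k x * b j x) t z
        - pathMoment ν b c (b k) t z * pathMoment ν b c (b j) t z *
          (pathMoment ν b c (fun _ => 1) t z)⁻¹) ^ 2 * (pathMoment ν b c (fun _ => 1) t z)⁻¹)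
        ∂stdGauss J) t := by
  have h1 : BddMeas (fun _ : X => (1 : ℝ)) := BddMeas.const 1
  have hgm := fun t => (measurable_pathMoment (ν := ν) (c := c) hb h1 t).inv
  have hgb := expBdd_inv_pathMoment_one (ν := ν) hb hc1
  have hm := fun {h : X → ℝ} (hh : BddMeas h) t => measurable_pathMoment (ν := ν) (c := c) hb hh t
  have hB := fun {h : X → ℝ} (hh : BddMeas h) => expBdd_pathMoment (ν := ν) hb hc1 hh
  have hbb := fun k j => (hb k).mul (hb j)
  have hbbb := fun k j => (hb k).mul ((hb j).pow 2)
  have hb2 := fun j => (hb j).pow 2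
  -- With `q` the moment of `bₖ bⱼ`, each summand of `Aⱼ` is `2 pₖ q/g - pₖ² pⱼ/g²`. In its
  -- `zⱼ`-derivative, the third-order moment and the term in `mⱼ` make up `Bⱼ`; what remains is the
  -- perfect square `2 (q - pₖ pⱼ/g)²/g`, a squared posterior covariance up to normalization.
  refine hasDerivAt_integral_stdGauss
    (f := fun t z => ∑ k, ε k * (pathMoment ν b c (b k) t z ^ 2 *
        (pathMoment ν b c (fun _ => 1) t z)⁻¹))
    (D := fun j t z => ∑ k, ε k * (2 * (pathMoment ν b c (fun x => b k x * b j x) t z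
        - pathMoment ν b c (b k) t z * pathMoment ν b c (b j) t z *
          (pathMoment ν b c (fun _ => 1) t z)⁻¹) ^ 2 * (pathMoment ν b c (fun _ => 1) t z)⁻¹))
    (A := fun j t z => ∑ k, ε k * (2 * pathMoment ν b c (b k) t z *
        pathMoment ν b c (fun x => b k x * b j x) t z * (pathMoment ν b c (fun _ => 1) t z)⁻¹
      - pathMoment ν b c (b k) t z ^ 2 * pathMoment ν b c (b j) t z *
        (pathMoment ν b c (fun _ => 1) t z)⁻¹ ^ 2))
    (B := fun j t z => ∑ k, ε k * (2 * pathMoment ν b c (b k) t z *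
        pathMoment ν b c (fun x => b k x * b j x ^ 2) t z * (pathMoment ν b c (fun _ => 1) t z)⁻¹
      - pathMoment ν b c (b k) t z ^ 2 * pathMoment ν b c (fun x => b j x ^ 2) t z *
        (pathMoment ν b c (fun _ => 1) t z)⁻¹ ^ 2))
    hc1 hc1'
    (fun t => Finset.measurable_fun_sum _ fun k _ =>
      (((hm (hb k) t).pow_const 2).mul (hgm t)).const_mul _)
    (fun j t => Finset.measurable_fun_sum _ fun k _ =>
      (((((hm (hb k) t).const_mul 2).mul (hm (hbb k j) t)).mul (hgm t)).sub
        ((((hm (hb k) t).pow_const 2).mul (hm (hb j) t)).mul ((hgm t).pow_const 2))).const_mul _)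
    (fun j t => Finset.measurable_fun_sum _ fun k _ =>
      (((((hm (hb k) t).const_mul 2).mul (hm (hbbb k j) t)).mul (hgm t)).sub
        ((((hm (hb k) t).pow_const 2).mul (hm (hb2 j) t)).mul ((hgm t).pow_const 2))).const_mul _)
    (fun j t => Finset.measurable_fun_sum _ fun k _ =>
      (((((hm (hbb k j) t).sub (((hm (hb k) t).mul (hm (hb j) t)).mul (hgm t))).pow_const
        2).const_mul 2).mul (hgm t)).const_mul _)
    (ExpBdd.sum fun k _ => (ExpBdd.const _).mul (((hB (hb k)).pow 2).mul hgb))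
    (fun j => ExpBdd.sum fun k _ => (ExpBdd.const _).mul
      (((((ExpBdd.const 2).mul (hB (hb k))).mul (hB (hbb k j))).mul hgb).sub
        ((((hB (hb k)).pow 2).mul (hB (hb j))).mul (hgb.pow 2))))
    (fun j => ExpBdd.sum fun k _ => (ExpBdd.const _).mul
      (((((ExpBdd.const 2).mul (hB (hb k))).mul (hB (hbbb k j))).mul hgb).sub
        ((((hB (hb k)).pow 2).mul (hB (hb2 j))).mul (hgb.pow 2))))
    (fun j => ExpBdd.sum fun k _ => (ExpBdd.const _).mul
      (((ExpBdd.const 2).mul (((hB (hbb k j)).sub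
        (((hB (hb k)).mul (hB (hb j))).mul hgb)).pow 2)).mul hgb))
    (fun t z => ?_) (fun j t z => ?_) t
  · have h0 := (pathMoment_one_pos (ν := ν) (c := c) hb t z).ne'
    have hg := hasDerivAt_pathMoment_time (ν := ν) hb hc h1 t z
    have hp := fun k => hasDerivAt_pathMoment_time (ν := ν) hb hc (hb k) t z
    refine (HasDerivAt.fun_sum fun k _ =>
      (((hp k).pow 2).mul (hg.inv h0)).const_mul (ε k)).congr_deriv ?_
    simp only [one_mul, Finset.mul_sum, Finset.sum_mul, ← Finset.sum_add_distrib, Finset.sum_div,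
      ← Finset.sum_neg_distrib, ← Finset.sum_sub_distrib, Pi.pow_apply, Pi.inv_apply]
    rw [Finset.sum_comm]
    refine Finset.sum_congr rfl fun j _ => Finset.sum_congr rfl fun k _ => ?_
    rw [div_eq_mul_inv, ← inv_pow]
    push_cast
    ring
  · have h0 := (pathMoment_one_pos (ν := ν) (c := c) hb t z).ne'
    have hg := (hasDerivAt_pathMoment_space (ν := ν) (c := c) hb h1 j t z).inv (by simpa using h0)
    have hp := fun k => hasDerivAt_pathMoment_space (ν := ν) (c := c) hb (hb k) j t z
    have hpp := fun k => hasDerivAt_pathMoment_space (ν := ν) (c := c) hb (hbb k j) j t z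
    refine (HasDerivAt.fun_sum fun k _ => (((((hp k).const_mul 2).mul (hpp k)).mul hg).sub
      ((((hp k).pow 2).mul (hp j)).mul (hg.pow 2))).const_mul (ε k)).congr_deriv ?_
    simp only [one_mul, Function.update_eq_self, Finset.mul_sum, ← Finset.sum_add_distrib,
      Pi.pow_apply, Pi.inv_apply, Pi.mul_apply]
    refine Finset.sum_congr rfl fun k _ => ?_
    have e1 : (fun x => b k x * b j x * b j x) = fun x => b k x * b j x ^ 2 := by
      funext x; ring
    have e2 : (fun x => b j x * b j x) = fun x => b j x ^ 2 := by
      funext x; ring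
    rw [e1, e2, div_eq_mul_inv, ← inv_pow]
    push_cast
    ring

end PathMoment

/-! ### Monotonicity of the energy under rotation, and the convexity inequality for bounded signals
-/

section Monotone

variable {X J ι κ : Type*} [Fintype J]

/-- The likelihood ratio between the Gaussian laws with means `b` and `0`. -/
def likRatio (b z : J → ℝ) : ℝ := Real.exp (∑ j, (b j * z j - b j ^ 2 / 2))

variable [MeasurableSpace X]

/-- The integral of `h` against the likelihood ratio of the channel with mean `B`. -/
def moment (ν : Measure X) (B : X → J → ℝ) (h : X → ℝ) (z : J → ℝ) : ℝ :=
  ∫ x, h x * likRatio (B x) z ∂ν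

lemma measurable_uncurry_likRatio {B : X → J → ℝ} (hB : Measurable B) :
    Measurable fun p : X × (J → ℝ) => likRatio (B p.1) p.2 := by
  have h1 : ∀ j, Measurable fun p : X × (J → ℝ) => B p.1 j := fun j =>
    (measurable_pi_apply j).comp (hB.comp measurable_fst)
  have h2 : ∀ j, Measurable fun p : X × (J → ℝ) => p.2 j := fun j =>
    (measurable_pi_apply j).comp measurable_snd
  exact (Finset.measurable_fun_sum _ fun j _ =>
    ((h1 j).mul (h2 j)).sub (((h1 j).pow_const 2).div_const 2)).exp

lemma measurable_moment {ν : Measure X} [SFinite ν] {B : X → J → ℝ} (hB : Measurable B)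
    {h : X → ℝ} (hh : Measurable h) : Measurable (moment ν B h) := by
  have : Measurable (Function.uncurry fun (z : J → ℝ) (x : X) => h x * likRatio (B x) z) :=
    (hh.comp measurable_snd).mul ((measurable_uncurry_likRatio hB).comp measurable_swap)
  exact this.stronglyMeasurable.integral_prod_right.measurable

lemma _root_.MeasureTheory.MeasurePreserving.integral_comp_of_measurable {α β : Type*}
    [MeasurableSpace α] [MeasurableSpace β] {μ : Measure α} {ν : Measure β} {f : α → β}
    (hf : MeasurePreserving f μ ν) {g : β → ℝ} (hg : Measurable g) :
    ∫ x, g (f x) ∂μ = ∫ y, g y ∂ν := by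
  rw [← hf.map_eq, integral_map hf.measurable.aemeasurable hg.aestronglyMeasurable]

/-- Weighted covariance matrices are positive semidefinite. -/
lemma posSemidef_cov {ν : Measure X} [IsFiniteMeasure ν] {b : J → X → ℝ} {w : X → ℝ}
    (hb : ∀ j, BddMeas (b j)) (hw : BddMeas w) (hw0 : ∀ x, 0 ≤ w x) :
    (Matrix.of fun k j => ∫ x, b k x * b j x * w x ∂ν
      - (∫ x, b k x * w x ∂ν) * (∫ x, b j x * w x ∂ν) * (∫ x, w x ∂ν)⁻¹).PosSemidef := by
  refine Matrix.posSemidef_iff_dotProduct_mulVec.2 ⟨?_, fun v => ?_⟩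
  · ext k j
    simp only [Matrix.conjTranspose_apply, Matrix.of_apply, star_trivial]
    rw [mul_comm (∫ x, b j x * w x ∂ν)]
    simp only [mul_comm (b j _)]
  -- The quadratic form at `v` is the weighted variance of the single function `∑ⱼ vⱼ bⱼ`, up to
  -- normalization, so Cauchy-Schwarz suffices.
  · have hs : BddMeas (fun x => ∑ j, v j * b j x) := BddMeas.sum fun j => (BddMeas.const _).mul (hb j)
    have key := sq_integral_mul_div_le hw0 hw.integrable (hs.mul hw).integrable (ν := ν)
      ((hs.pow 2).mul hw).integrable
    have e1 : ∫ x, (∑ j, v j * b j x) * w x ∂ν = ∑ j, v j * ∫ x, b j x * w x ∂ν := by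
      simp only [Finset.sum_mul, mul_assoc]
      rw [integral_finsetSum _ fun j _ => (((hb j).mul hw).integrable).const_mul _]
      simp only [integral_const_mul]
    have e2 : ∫ x, (∑ j, v j * b j x) ^ 2 * w x ∂ν
        = ∑ k, ∑ j, v k * (v j * ∫ x, b k x * b j x * w x ∂ν) := by
      have : ∀ x, (∑ j, v j * b j x) ^ 2 * w x
          = ∑ k, ∑ j, v k * (v j * (b k x * b j x * w x)) := fun x => by
        rw [pow_two, Finset.sum_mul_sum, Finset.sum_mul]
        refine Finset.sum_congr rfl fun k _ => ?_
        rw [Finset.sum_mul]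
        exact Finset.sum_congr rfl fun j _ => by ring
      simp only [this]
      have hi := fun k j => ((((hb k).mul (hb j)).mul hw).integrable (ν := ν)).const_mul (v j)
      rw [integral_finsetSum _ fun k _ => integrable_finsetSum _ fun j _ => (hi k j).const_mul _]
      refine Finset.sum_congr rfl fun k _ => ?_
      rw [integral_finsetSum _ fun j _ => (hi k j).const_mul _]
      simp only [integral_const_mul]
    rw [e1, e2] at key
    rw [← sub_nonneg] at key
    refine key.trans_eq ?_
    simp only [dotProduct, Matrix.mulVec, Matrix.of_apply, star_trivial]
    rw [pow_two, Finset.sum_mul_sum, Finset.sum_div, ← Finset.sum_sub_distrib]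
    refine Finset.sum_congr rfl fun k _ => ?_
    rw [Finset.sum_div, ← Finset.sum_sub_distrib, Finset.mul_sum]
    exact Finset.sum_congr rfl fun j _ => by ring

/-- By the Schur product theorem, the entrywise square of a covariance matrix is positive
semidefinite. The sum is its quadratic form at `ε`, so the signs of `ε` do no harm. -/
lemma sum_sq_cov_nonneg {ν : Measure X} [IsFiniteMeasure ν] {b : J → X → ℝ} {w : X → ℝ}
    (hb : ∀ j, BddMeas (b j)) (hw : BddMeas w) (hw0 : ∀ x, 0 ≤ w x) (ε : J → ℝ) :
    0 ≤ ∑ j, ε j * ∑ k, ε k * (2 * (∫ x, b k x * b j x * w x ∂ν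
      - (∫ x, b k x * w x ∂ν) * (∫ x, b j x * w x ∂ν) * (∫ x, w x ∂ν)⁻¹) ^ 2 *
        (∫ x, w x ∂ν)⁻¹) := by
  have h := posSemidef_cov (ν := ν) hb hw hw0
  have h2 := (Matrix.posSemidef_iff_dotProduct_mulVec.1 (h.hadamard h)).2 ε
  have h3 := mul_nonneg h2 (inv_nonneg.2 (integral_nonneg (μ := ν) hw0))
  refine (mul_nonneg zero_le_two h3).trans_eq ?_
  simp only [dotProduct, Matrix.mulVec, Matrix.of_apply, star_trivial, Finset.mul_sum,
    Finset.sum_mul, Matrix.hadamard_apply]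
  rw [Finset.sum_comm]
  exact Finset.sum_congr rfl fun k _ => Finset.sum_congr rfl fun j _ => by ring

/-- The rotation that moves a channel on the noise coordinates `ι` to one on `κ`. -/
def rot : ι ⊕ κ → ℝ → ℝ := Sum.elim (fun _ => Real.cos) fun _ => Real.sin

/-- The derivative of `rot`. -/
def rotDeriv : ι ⊕ κ → ℝ → ℝ := Sum.elim (fun _ t => -Real.sin t) fun _ => Real.cos

/-- The signs of the derivatives of the squares of `rot`. -/
def rotSign : ι ⊕ κ → ℝ := Sum.elim (fun _ => -1) fun _ => 1

lemma rot_mul_rotDeriv (j : ι ⊕ κ) (t : ℝ) :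
    rot j t * rotDeriv j t = Real.sin t * Real.cos t * rotSign j := by
  rcases j with j | j <;> simp [rot, rotDeriv, rotSign, mul_comm]

lemma abs_rot_le (j : ι ⊕ κ) (t : ℝ) : |rot j t| ≤ 1 := by
  rcases j with j | j
  · exact Real.abs_cos_le_one t
  · exact Real.abs_sin_le_one t

lemma abs_rotDeriv_le (j : ι ⊕ κ) (t : ℝ) : |rotDeriv j t| ≤ 1 := by
  rcases j with j | j
  · simpa [rotDeriv] using Real.abs_sin_le_one t
  · exact Real.abs_cos_le_one t

lemma hasDerivAt_rot (j : ι ⊕ κ) (t : ℝ) : HasDerivAt (rot j) (rotDeriv j t) t := by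
  rcases j with j | j
  · exact Real.hasDerivAt_cos t
  · exact Real.hasDerivAt_sin t

variable [Fintype ι] [Fintype κ]

/-- At angle `t` the coordinates in `ι` have means `cos t · b` and those in `κ` have means `sin t ·
b`. The entropy has derivative `sin t cos t · E(t)`, and the signed energy `E` has derivative `sin t
cos t` times a nonnegative number. So `E(t) ≥ E(0)` on `[0, π/2]`, and `sin t cos t` has total mass
`1/2` there. -/
lemma entropy_path_le {ν : Measure X} [IsFiniteMeasure ν] [NeZero ν] {b : ι ⊕ κ → X → ℝ}
    (hb : ∀ j, BddMeas (b j)) :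
    ∫ z, InformationTheory.klFun (pathMoment ν b rot (fun _ => 1) 0 z) ∂stdGauss (ι ⊕ κ)
      + 1 / 2 * ∫ z, ∑ k, rotSign k * (pathMoment ν b rot (b k) 0 z ^ 2 *
        (pathMoment ν b rot (fun _ => 1) 0 z)⁻¹) ∂stdGauss (ι ⊕ κ)
    ≤ ∫ z, InformationTheory.klFun (pathMoment ν b rot (fun _ => 1) (Real.pi / 2) z)
        ∂stdGauss (ι ⊕ κ) := by
  classical
  set F := fun t => ∫ z, InformationTheory.klFun (pathMoment ν b rot (fun _ => 1) t z)
    ∂stdGauss (ι ⊕ κ) with hFdef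
  set E := fun t => ∫ z, ∑ k, rotSign k * (pathMoment ν b rot (b k) t z ^ 2 *
    (pathMoment ν b rot (fun _ => 1) t z)⁻¹) ∂stdGauss (ι ⊕ κ) with hEdef
  change F 0 + 1 / 2 * E 0 ≤ F (Real.pi / 2)
  have h1 : BddMeas (fun _ : X => (1 : ℝ)) := BddMeas.const 1
  have hgm := fun t => (measurable_pathMoment (ν := ν) (c := rot) hb h1 t).inv
  have hgb := expBdd_inv_pathMoment_one (ν := ν) hb abs_rot_le
  have hm := fun {h : X → ℝ} (hh : BddMeas h) t =>
    measurable_pathMoment (ν := ν) (c := rot) hb hh t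
  have hB := fun {h : X → ℝ} (hh : BddMeas h) => expBdd_pathMoment (ν := ν) hb abs_rot_le hh
  have hF : ∀ t, HasDerivAt F (Real.sin t * Real.cos t * E t) t := by
    intro t
    refine (hasDerivAt_entropy hb abs_rot_le abs_rotDeriv_le hasDerivAt_rot t).congr_deriv ?_
    rw [hEdef]
    simp only []
    rw [integral_finsetSum _ fun k _ => ((((hB (hb k)).pow 2).mul hgb).integrable t
      (((hm (hb k) t).pow_const 2).mul (hgm t))).const_mul _, Finset.mul_sum]
    refine Finset.sum_congr rfl fun j _ => ?_
    rw [rot_mul_rotDeriv, integral_const_mul, mul_assoc]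
  have hE : ∀ t, ∃ N, 0 ≤ N ∧ HasDerivAt E (Real.sin t * Real.cos t * N) t := by
    intro t
    have hbb := fun k j => (hb k).mul (hb j)
    refine ⟨∫ z, ∑ j, rotSign j * ∑ k, rotSign k *
      (2 * (pathMoment ν b rot (fun x => b k x * b j x) t z
        - pathMoment ν b rot (b k) t z * pathMoment ν b rot (b j) t z *
          (pathMoment ν b rot (fun _ => 1) t z)⁻¹) ^ 2 *
        (pathMoment ν b rot (fun _ => 1) t z)⁻¹) ∂stdGauss (ι ⊕ κ),
      integral_nonneg fun z => ?_,
      (hasDerivAt_energy hb abs_rot_le abs_rotDeriv_le hasDerivAt_rot rotSign t).congr_deriv ?_⟩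
    · have := sum_sq_cov_nonneg (ν := ν) hb
        (BddMeas.expWeight (BddMeas.tiltFun hb) (tiltParam (fun j => rot j t) z))
        (fun x => (Real.exp_pos _).le) rotSign
      simp only [pathMoment, expMoment, one_mul, Pi.zero_apply]
      exact this
    · rw [integral_finsetSum, Finset.mul_sum]
      · refine Finset.sum_congr rfl fun j _ => ?_
        rw [rot_mul_rotDeriv, integral_const_mul, mul_assoc]
      · intro j _
        refine Integrable.const_mul ?_ _
        refine integrable_finsetSum _ fun k _ => Integrable.const_mul ?_ _
        exact (((ExpBdd.const 2).mul (((hB (hbb k j)).sub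
          (((hB (hb k)).mul (hB (hb j))).mul hgb)).pow 2)).mul hgb).integrable t
          (((((hm (hbb k j) t).sub (((hm (hb k) t).mul (hm (hb j) t)).mul (hgm t))).pow_const
            2).const_mul 2).mul (hgm t))
  have hsc : ∀ t ∈ Set.Icc 0 (Real.pi / 2), 0 ≤ Real.sin t * Real.cos t := fun t ht =>
    mul_nonneg (Real.sin_nonneg_of_nonneg_of_le_pi ht.1 (by linarith [ht.2, Real.pi_pos]))
      (Real.cos_nonneg_of_neg_pi_div_two_le_of_le (by linarith [ht.1, Real.pi_pos]) ht.2)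
  have hpi : (0 : ℝ) ≤ Real.pi / 2 := by positivity
  have hmono : MonotoneOn E (Set.Icc 0 (Real.pi / 2)) := by
    refine monotoneOn_of_deriv_nonneg (convex_Icc _ _)
      (fun t _ => (hE t).choose_spec.2.continuousAt.continuousWithinAt)
      (fun t _ => (hE t).choose_spec.2.differentiableAt.differentiableWithinAt) fun t ht => ?_
    rw [(hE t).choose_spec.2.deriv]
    exact mul_nonneg (hsc t (interior_subset ht)) (hE t).choose_spec.1
  -- Subtracting `E 0` times the antiderivative `sin² t / 2` of `sin t cos t` turns the integrated
  -- bound into monotonicity; the `1/2` of the statement is its value at `π/2`.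
  have hG : ∀ t, HasDerivAt (fun t => F t - Real.sin t ^ 2 / 2 * E 0)
      (Real.sin t * Real.cos t * (E t - E 0)) t := by
    intro t
    refine ((hF t).sub ((((Real.hasDerivAt_sin t).pow 2).div_const 2).mul_const (E 0))).congr_deriv
      ?_
    push_cast
    ring
  have hGm : MonotoneOn (fun t => F t - Real.sin t ^ 2 / 2 * E 0) (Set.Icc 0 (Real.pi / 2)) := by
    refine monotoneOn_of_deriv_nonneg (convex_Icc _ _)
      (fun t _ => (hG t).continuousAt.continuousWithinAt)
      (fun t _ => (hG t).differentiableAt.differentiableWithinAt) fun t ht => ?_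
    rw [(hG t).deriv]
    exact mul_nonneg (hsc t (interior_subset ht)) (sub_nonneg.2
      (hmono (Set.left_mem_Icc.2 hpi) (interior_subset ht) (interior_subset ht).1))
  have := hGm (Set.left_mem_Icc.2 hpi) (Set.right_mem_Icc.2 hpi) hpi
  simp only [Real.sin_zero, Real.sin_pi_div_two] at this
  linarith

lemma measurePreserving_comp_inl :
    MeasurePreserving (fun z : ι ⊕ κ → ℝ => fun i => z (Sum.inl i)) (stdGauss (ι ⊕ κ))
      (stdGauss ι) :=
  measurePreserving_fst.comp
    (measurePreserving_sumPiEquivProdPi (fun _ : ι ⊕ κ => gaussianReal 0 1))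

lemma measurePreserving_comp_inr :
    MeasurePreserving (fun z : ι ⊕ κ → ℝ => fun i => z (Sum.inr i)) (stdGauss (ι ⊕ κ))
      (stdGauss κ) :=
  measurePreserving_snd.comp
    (measurePreserving_sumPiEquivProdPi (fun _ : ι ⊕ κ => gaussianReal 0 1))

lemma pathMoment_rot_zero (ν : Measure X) (b : ι ⊕ κ → X → ℝ) (h : X → ℝ) (z : ι ⊕ κ → ℝ) :
    pathMoment ν b rot h 0 z = moment ν (fun x i => b (Sum.inl i) x) h fun i => z (Sum.inl i) := by
  simp only [pathMoment, expMoment, sum_tilt]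
  simp [moment, likRatio, rot]

lemma pathMoment_rot_pi_div_two (ν : Measure X) (b : ι ⊕ κ → X → ℝ) (h : X → ℝ)
    (z : ι ⊕ κ → ℝ) : pathMoment ν b rot h (Real.pi / 2) z
      = moment ν (fun x i => b (Sum.inr i) x) h fun i => z (Sum.inr i) := by
  simp only [pathMoment, expMoment, sum_tilt]
  simp [moment, likRatio, rot]

/-- Convexity of the relative entropy in the channel, for bounded signals: the relative entropy
lies above its linear approximation at any other channel. -/
lemma entropy_add_le_of_bddMeas {ν : Measure X} [IsFiniteMeasure ν] [NeZero ν] {B : X → ι → ℝ}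
    {B' : X → κ → ℝ} (hB : ∀ i, BddMeas fun x => B x i) (hB' : ∀ i, BddMeas fun x => B' x i) :
    ∫ z, InformationTheory.klFun (moment ν B (fun _ => 1) z) ∂stdGauss ι
      + 1 / 2 * ∫ z, (∑ k, moment ν B (fun x => B' x k) z ^ 2 * (moment ν B (fun _ => 1) z)⁻¹
        - ∑ k, moment ν B (fun x => B x k) z ^ 2 * (moment ν B (fun _ => 1) z)⁻¹) ∂stdGauss ι
    ≤ ∫ z, InformationTheory.klFun (moment ν B' (fun _ => 1) z) ∂stdGauss κ := by
  have hb : ∀ j, BddMeas (Sum.elim (fun i x => B x i) (fun i x => B' x i) j : X → ℝ) := by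
    rintro (j | j)
    · exact hB j
    · exact hB' j
  have key := entropy_path_le (ν := ν) hb
  have hBm : Measurable B := measurable_pi_lambda _ fun i => (hB i).1
  have hBm' : Measurable B' := measurable_pi_lambda _ fun i => (hB' i).1
  have hm : ∀ {h : X → ℝ}, Measurable h → Measurable (moment ν B h) := measurable_moment hBm
  simp only [pathMoment_rot_zero, pathMoment_rot_pi_div_two, Fintype.sum_sum_type, Sum.elim_inl,
    Sum.elim_inr, rotSign, neg_mul, one_mul, Finset.sum_neg_distrib, neg_add_eq_sub] at key
  rw [measurePreserving_comp_inl.integral_comp_of_measurable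
      (g := fun z => InformationTheory.klFun (moment ν B (fun _ => 1) z))
      (InformationTheory.measurable_klFun.comp (hm measurable_const)),
    measurePreserving_comp_inr.integral_comp_of_measurable
      (g := fun z => InformationTheory.klFun (moment ν B' (fun _ => 1) z))
      (InformationTheory.measurable_klFun.comp (measurable_moment hBm' measurable_const)),
    measurePreserving_comp_inl.integral_comp_of_measurable
      (g := fun z => ∑ k, moment ν B (fun x => B' x k) z ^ 2 * (moment ν B (fun _ => 1) z)⁻¹
        - ∑ k, moment ν B (fun x => B x k) z ^ 2 * (moment ν B (fun _ => 1) z)⁻¹)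
      ((Finset.measurable_fun_sum _ fun k _ =>
        ((hm (hB' k).1).pow_const 2).mul (hm measurable_const).inv).sub
        (Finset.measurable_fun_sum _ fun k _ =>
          ((hm (hB k).1).pow_const 2).mul (hm measurable_const).inv))] at key
  exact key

end Monotone

/-! ### Likelihood ratios, the density of the channel output, and finiteness of the entropy -/

section LikRatio

variable {X J : Type*} [Fintype J] [MeasurableSpace X]

lemma likRatio_pos (b z : J → ℝ) : 0 < likRatio b z := Real.exp_pos _

/-- Completing the square. The bound does not involve the mean `b`, so for fixed output the
likelihood ratio is bounded over all signals, even unbounded ones. -/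
lemma likRatio_le (b z : J → ℝ) : likRatio b z ≤ Real.exp (∑ j, z j ^ 2 / 2) :=
  Real.exp_le_exp.2 (Finset.sum_le_sum fun j _ => by nlinarith [sq_nonneg (b j - z j)])

lemma measurable_likRatio (b : J → ℝ) : Measurable (likRatio b) := by
  unfold likRatio
  fun_prop

lemma gaussianReal_one_eq_withDensity (m : ℝ) :
    gaussianReal m 1
      = (gaussianReal 0 1).withDensity fun s => ENNReal.ofReal (Real.exp (m * s - m ^ 2 / 2)) := by
  rw [gaussianReal_of_var_ne_zero _ one_ne_zero, gaussianReal_of_var_ne_zero _ one_ne_zero,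
    ← withDensity_mul _ (measurable_gaussianPDF 0 1) (by fun_prop)]
  congr 1
  funext s
  simp only [Pi.mul_apply, gaussianPDF]
  rw [← ENNReal.ofReal_mul (gaussianPDFReal_nonneg _ _ _)]
  congr 1
  simp only [gaussianPDFReal]
  rw [mul_assoc _ (Real.exp _), ← Real.exp_add]
  congr 2
  push_cast
  ring

/-- The Cameron-Martin formula for the standard Gaussian measure. -/
lemma map_add_stdGauss (b : J → ℝ) :
    (stdGauss J).map (fun z => b + z)
      = (stdGauss J).withDensity fun z => ENNReal.ofReal (likRatio b z) := by
  have h1 : (stdGauss J).map (fun z => b + z) = Measure.pi fun j => gaussianReal (b j) 1 := by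
    have := Measure.pi_map_pi (μ := fun _ : J => gaussianReal 0 1) (f := fun j s => b j + s)
      fun j => (measurable_const_add (b j)).aemeasurable
    simp only [gaussianReal_map_const_add, zero_add] at this
    exact this
  rw [h1]
  refine Measure.pi_eq fun s hs => ?_
  have hi : ∀ j, Integrable (fun t => Real.exp (b j * t - b j ^ 2 / 2)) (gaussianReal 0 1) :=
    fun j => by
      simp only [Real.exp_sub]
      exact (integrable_exp_mul_gaussianReal (b j)).div_const _
  have e : ∀ z, likRatio b z = ∏ j, Real.exp (b j * z j - b j ^ 2 / 2) := fun z => by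
    rw [likRatio, Real.exp_sum]
  rw [withDensity_apply _ (MeasurableSet.univ_pi hs), stdGauss, Measure.restrict_pi_pi]
  simp only [e]
  rw [← ofReal_integral_eq_lintegral_ofReal
    (Integrable.fintype_prod fun j => (hi j).restrict)
    (ae_of_all _ fun z => Finset.prod_nonneg fun j _ => (Real.exp_pos _).le),
    integral_fintype_prod_eq_prod (fun j t => Real.exp (b j * t - b j ^ 2 / 2)),
    ENNReal.ofReal_prod_of_nonneg fun j _ => integral_nonneg fun t => (Real.exp_pos _).le]
  refine Finset.prod_congr rfl fun j _ => ?_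
  rw [ofReal_integral_eq_lintegral_ofReal (hi j).restrict
    (ae_of_all _ fun t => (Real.exp_pos _).le), gaussianReal_one_eq_withDensity (b j),
    withDensity_apply _ (hs j)]

lemma lintegral_likRatio (b : J → ℝ) :
    ∫⁻ z, ENNReal.ofReal (likRatio b z) ∂stdGauss J = 1 := by
  have h := congrArg (fun μ => μ Set.univ) (map_add_stdGauss b)
  simp only [withDensity_apply _ MeasurableSet.univ, Measure.restrict_univ] at h
  rw [← h, Measure.map_apply (measurable_const_add b) MeasurableSet.univ]
  simp

lemma expBdd_likRatio (b : J → ℝ) : ExpBdd fun _ : Unit => likRatio b := by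
  refine ⟨1, ∑ j, |b j|, zero_le_one, Finset.sum_nonneg fun _ _ => abs_nonneg _, fun _ z => ?_⟩
  rw [one_mul, abs_of_pos (likRatio_pos b z), likRatio, Finset.sum_mul]
  refine Real.exp_le_exp.2 (Finset.sum_le_sum fun j _ => ?_)
  have h1 : |z j| ≤ ∑ j, |z j| :=
    Finset.single_le_sum (f := fun j => |z j|) (fun i _ => abs_nonneg _) (Finset.mem_univ j)
  have h2 := mul_le_mul_of_nonneg_left h1 (abs_nonneg (b j))
  have h3 := le_abs_self (b j * z j)
  rw [abs_mul] at h3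
  nlinarith [sq_nonneg (b j)]

lemma integrable_likRatio (b : J → ℝ) : Integrable (likRatio b) (stdGauss J) :=
  (expBdd_likRatio b).integrable () (measurable_likRatio b)

lemma integral_likRatio (b : J → ℝ) : ∫ z, likRatio b z ∂stdGauss J = 1 := by
  rw [integral_eq_lintegral_of_nonneg_ae (ae_of_all _ fun z => (likRatio_pos b z).le)
    (measurable_likRatio b).aestronglyMeasurable, lintegral_likRatio, ENNReal.toReal_one]

lemma integral_coord_mul_likRatio (b : J → ℝ) (j : J) :
    ∫ z, z j * likRatio b z ∂stdGauss J = b j := by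
  classical
  rw [integral_coord_mul_stdGauss (h' := fun z => b j * likRatio b z) j (measurable_likRatio b)
    ((measurable_likRatio b).const_mul _) (expBdd_likRatio b)
    ((ExpBdd.const (b j)).mul (expBdd_likRatio b)), integral_const_mul, integral_likRatio, mul_one]
  intro z
  have h : HasDerivAt (fun s => ∑ k, (b k * Function.update z j s k - b k ^ 2 / 2)) (b j)
      (z j) := by
    refine (HasDerivAt.fun_sum (u := Finset.univ) (A' := fun k => if k = j then b j else 0)
      fun k _ => ?_).congr_deriv (by simp)
    by_cases hk : k = j
    · subst hk
      simpa using ((hasDerivAt_id (z k)).const_mul (b k)).sub_const (b k ^ 2 / 2)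
    · simpa [hk] using hasDerivAt_const (z j) (b k * z k)
  refine h.exp.congr_deriv ?_
  simp only [Function.update_eq_self, likRatio]
  ring

lemma klFun_likRatio (b z : J → ℝ) : InformationTheory.klFun (likRatio b z)
    = ∑ j, (b j * (z j * likRatio b z) - b j ^ 2 / 2 * likRatio b z) + 1 - likRatio b z := by
  rw [InformationTheory.klFun_apply]
  congr 2
  rw [likRatio, Real.log_exp, Finset.mul_sum]
  exact Finset.sum_congr rfl fun j _ => by ring

/-- This is the relative entropy between Gaussians with means `b` and `0`; its quadratic size is why
second moments of the signal suffice. -/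
lemma lintegral_klFun_likRatio (b : J → ℝ) :
    ∫⁻ z, ENNReal.ofReal (InformationTheory.klFun (likRatio b z)) ∂stdGauss J
      = ENNReal.ofReal (∑ j, b j ^ 2 / 2) := by
  have h1 : ∀ j : J, Integrable (fun z : J → ℝ => z j * likRatio b z) (stdGauss J) := fun j =>
    ((ExpBdd.coord (T := Unit) j).mul (expBdd_likRatio b)).integrable ()
      ((measurable_pi_apply j).mul (measurable_likRatio b))
  have h2 := integrable_likRatio b
  have h3 : ∀ j : J, Integrable
      (fun z : J → ℝ => b j * (z j * likRatio b z) - b j ^ 2 / 2 * likRatio b z) (stdGauss J) :=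
    fun j => ((h1 j).const_mul _).sub (h2.const_mul _)
  have h4 : Integrable (fun z : J → ℝ =>
      ∑ j, (b j * (z j * likRatio b z) - b j ^ 2 / 2 * likRatio b z)) (stdGauss J) :=
    integrable_finsetSum _ fun j _ => h3 j
  have h5 : Integrable (fun z => InformationTheory.klFun (likRatio b z)) (stdGauss J) := by
    simp only [klFun_likRatio]
    exact (h4.add (integrable_const 1)).sub h2
  rw [← ofReal_integral_eq_lintegral_ofReal h5
    (ae_of_all _ fun z => InformationTheory.klFun_nonneg (likRatio_pos b z).le)]
  congr 1
  simp only [klFun_likRatio]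
  rw [integral_sub (f := fun z =>
      ∑ j, (b j * (z j * likRatio b z) - b j ^ 2 / 2 * likRatio b z) + 1)
      (h4.add (integrable_const 1)) h2, integral_add h4 (integrable_const 1),
    integral_finsetSum _ fun j _ => h3 j, integral_likRatio]
  simp only [integral_const, probReal_univ, smul_eq_mul, mul_one, add_sub_cancel_right]
  refine Finset.sum_congr rfl fun j _ => ?_
  rw [integral_sub ((h1 j).const_mul _) (h2.const_mul _), integral_const_mul, integral_const_mul,
    integral_likRatio, integral_coord_mul_likRatio]
  ring

variable {P : Measure X} {B : X → J → ℝ}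

/-- The density of the channel output with respect to the noise. -/
lemma map_prod_stdGauss_eq_withDensity [IsFiniteMeasure P] (hB : Measurable B) :
    (P.prod (stdGauss J)).map (fun p => B p.1 + p.2)
      = (stdGauss J).withDensity fun z => ENNReal.ofReal (moment P B (fun _ => 1) z) := by
  have hm : Measurable fun p : X × (J → ℝ) => B p.1 + p.2 :=
    (hB.comp measurable_fst).add measurable_snd
  have hL : Measurable fun p : X × (J → ℝ) => ENNReal.ofReal (likRatio (B p.1) p.2) :=
    (measurable_uncurry_likRatio hB).ennreal_ofReal
  ext s hs
  rw [Measure.map_apply hm hs, Measure.prod_apply (hm hs), withDensity_apply _ hs]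
  have h1 : ∀ x, stdGauss J (Prod.mk x ⁻¹' ((fun p : X × (J → ℝ) => B p.1 + p.2) ⁻¹' s))
      = ∫⁻ z in s, ENNReal.ofReal (likRatio (B x) z) ∂stdGauss J := by
    intro x
    rw [← withDensity_apply _ hs, ← map_add_stdGauss,
      Measure.map_apply (measurable_const_add (B x)) hs]
    rfl
  simp only [h1]
  rw [lintegral_lintegral_swap hL.aemeasurable]
  refine lintegral_congr fun z => ?_
  have hz : Measurable fun x => likRatio (B x) z :=
    (measurable_uncurry_likRatio hB).comp (measurable_id.prodMk measurable_const)
  rw [← ofReal_integral_eq_lintegral_ofReal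
    ((integrable_const (Real.exp (∑ j, z j ^ 2 / 2))).mono' hz.aestronglyMeasurable
      (ae_of_all _ fun x => ?_)) (ae_of_all _ fun x => (likRatio_pos _ z).le)]
  · simp only [moment, one_mul]
  · rw [Real.norm_of_nonneg (likRatio_pos _ z).le]
    exact likRatio_le _ z

lemma measurable_likRatio_left (hB : Measurable B) (z : J → ℝ) :
    Measurable fun x => likRatio (B x) z :=
  (measurable_uncurry_likRatio hB).comp (measurable_id.prodMk measurable_const)

lemma integrable_mul_likRatio (hB : Measurable B) {h : X → ℝ} (hh : Integrable h P) (z : J → ℝ) :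
    Integrable (fun x => h x * likRatio (B x) z) P := by
  refine hh.mul_bdd (c := Real.exp (∑ j, z j ^ 2 / 2))
    (measurable_likRatio_left hB z).aestronglyMeasurable (ae_of_all _ fun x => ?_)
  rw [Real.norm_of_nonneg (likRatio_pos _ z).le]
  exact likRatio_le _ z

lemma integrable_prod_mul_likRatio [SFinite P] (hB : Measurable B) {h : X → ℝ}
    (hh : Integrable h P) :
    Integrable (fun p : X × (J → ℝ) => h p.1 * likRatio (B p.1) p.2) (P.prod (stdGauss J)) := by
  refine (integrable_prod_iff (hh.aestronglyMeasurable.comp_fst.mul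
    (measurable_uncurry_likRatio hB).aestronglyMeasurable)).2
    ⟨ae_of_all _ fun x => (integrable_likRatio (B x)).const_mul (h x), ?_⟩
  refine hh.norm.congr (ae_of_all _ fun x => ?_)
  simp only [Pi.mul_apply, norm_mul, Real.norm_of_nonneg (likRatio_pos _ _).le, integral_const_mul,
    integral_likRatio, mul_one]

lemma integrable_moment [SFinite P] (hB : Measurable B) {h : X → ℝ} (hh : Integrable h P) :
    Integrable (moment P B h) (stdGauss J) :=
  (integrable_prod_mul_likRatio hB hh).integral_prod_right

lemma integral_moment [SFinite P] (hB : Measurable B) {h : X → ℝ} (hh : Integrable h P) :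
    ∫ z, moment P B h z ∂stdGauss J = ∫ x, h x ∂P := by
  simp only [moment]
  rw [← integral_integral_swap (f := fun x z => h x * likRatio (B x) z)
    (integrable_prod_mul_likRatio hB hh)]
  simp only [integral_const_mul, integral_likRatio, mul_one]

lemma moment_one_nonneg (z : J → ℝ) : 0 ≤ moment P B (fun _ => 1) z :=
  integral_nonneg fun x => by simpa using (likRatio_pos (B x) z).le

lemma moment_one_pos [IsFiniteMeasure P] [NeZero P] (hB : Measurable B) (z : J → ℝ) :
    0 < moment P B (fun _ => 1) z := by
  refine (integral_pos_iff_support_of_nonneg (fun x => ?_)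
    (integrable_mul_likRatio hB (integrable_const 1) z)).2 ?_
  · simpa using (likRatio_pos (B x) z).le
  · have : (Function.support fun x => (1 : ℝ) * likRatio (B x) z) = Set.univ := by
      ext x
      simpa using (likRatio_pos (B x) z).ne'
    rw [this]
    exact pos_iff_ne_zero.2 (NeZero.ne _)

/-- Cauchy-Schwarz under the posterior. The right-hand side integrates to the prior second moment
and serves as dominating function for energies. -/
lemma sq_moment_le [IsFiniteMeasure P] (hB : Measurable B) {h : X → ℝ} (hh : MemLp h 2 P)
    (z : J → ℝ) : moment P B h z ^ 2 * (moment P B (fun _ => 1) z)⁻¹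
      ≤ moment P B (fun x => h x ^ 2) z := by
  have := sq_integral_mul_div_le (ν := P) (h := h) (w := fun x => likRatio (B x) z)
    (fun x => (likRatio_pos _ z).le)
    (by simpa using integrable_mul_likRatio hB (integrable_const (1 : ℝ)) z)
    (integrable_mul_likRatio hB (hh.integrable one_le_two) z)
    (integrable_mul_likRatio hB hh.integrable_sq z)
  simpa only [moment, one_mul, div_eq_mul_inv] using this

/-- By Jensen, the entropy of a mixture is at most the average of the entropies of its Gaussian
components, which is half the second moment of the mean. -/
lemma lintegral_klFun_moment_lt_top [IsProbabilityMeasure P] (hB : Measurable B)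
    (hB2 : ∀ j, MemLp (fun x => B x j) 2 P) :
    ∫⁻ z, ENNReal.ofReal (InformationTheory.klFun (moment P B (fun _ => 1) z)) ∂stdGauss J
      < ⊤ := by
  have hL := measurable_uncurry_likRatio hB
  have hkm : Measurable fun p : X × (J → ℝ) =>
      ENNReal.ofReal (InformationTheory.klFun (likRatio (B p.1) p.2)) :=
    (InformationTheory.measurable_klFun.comp hL).ennreal_ofReal
  have hJ : ∀ z, ENNReal.ofReal (InformationTheory.klFun (moment P B (fun _ => 1) z))
      ≤ ∫⁻ x, ENNReal.ofReal (InformationTheory.klFun (likRatio (B x) z)) ∂P := by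
    intro z
    have h1 : Integrable (fun x => likRatio (B x) z) P := by
      simpa using integrable_mul_likRatio hB (integrable_const (1 : ℝ)) z
    obtain ⟨C, hC⟩ := (isCompact_Icc (a := (0 : ℝ))
      (b := Real.exp (∑ j, z j ^ 2 / 2))).exists_bound_of_continuousOn
      InformationTheory.continuous_klFun.continuousOn
    have h2 : Integrable (fun x => InformationTheory.klFun (likRatio (B x) z)) P :=
      (integrable_const C).mono'
        (InformationTheory.measurable_klFun.comp
          (measurable_likRatio_left hB z)).aestronglyMeasurable
        (ae_of_all _ fun x => hC _ ⟨(likRatio_pos _ z).le, likRatio_le _ z⟩)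
    have h3 := InformationTheory.convexOn_klFun.map_integral_le
      InformationTheory.continuous_klFun.continuousOn isClosed_Ici
      (ae_of_all P fun x => (likRatio_pos (B x) z).le) h1 h2
    rw [← ofReal_integral_eq_lintegral_ofReal h2
      (ae_of_all _ fun x => InformationTheory.klFun_nonneg (likRatio_pos _ z).le)]
    refine ENNReal.ofReal_le_ofReal ?_
    simpa only [moment, one_mul] using h3
  refine (lintegral_mono hJ).trans_lt ?_
  rw [lintegral_lintegral_swap (f := fun z x =>
    ENNReal.ofReal (InformationTheory.klFun (likRatio (B x) z)))
    (hkm.comp measurable_swap).aemeasurable]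
  simp only [lintegral_klFun_likRatio]
  have : Integrable (fun x => ∑ j, B x j ^ 2 / 2) P :=
    integrable_finsetSum _ fun j _ => (hB2 j).integrable_sq.div_const 2
  exact this.lintegral_lt_top

lemma integrable_klFun_moment [IsProbabilityMeasure P] (hB : Measurable B)
    (hB2 : ∀ j, MemLp (fun x => B x j) 2 P) :
    Integrable (fun z => InformationTheory.klFun (moment P B (fun _ => 1) z)) (stdGauss J) := by
  have hm : Measurable fun z => InformationTheory.klFun (moment P B (fun _ => 1) z) :=
    InformationTheory.measurable_klFun.comp (measurable_moment hB measurable_const)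
  exact (lintegral_ofReal_ne_top_iff_integrable hm.aestronglyMeasurable
    (ae_of_all _ fun z => InformationTheory.klFun_nonneg (moment_one_nonneg z))).1
    (lintegral_klFun_moment_lt_top hB hB2).ne

end LikRatio

/-- `klFun` decreases from `1` to `0` on `[0, 1]` and increases afterwards, so monotonicity fails by
at most `1`. This dominates the entropies of truncated signals, whose densities are smaller. -/
lemma klFun_le_one_add_klFun {u v : ℝ} (hu : 0 ≤ u) (huv : u ≤ v) :
    InformationTheory.klFun u ≤ 1 + InformationTheory.klFun v := by
  have hv := InformationTheory.klFun_nonneg (hu.trans huv)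
  rcases le_total u 1 with h1 | h1
  · have : InformationTheory.klFun u ≤ 1 := by
      rw [InformationTheory.klFun_apply]
      nlinarith [Real.mul_log_nonpos hu h1]
    linarith
  · have : InformationTheory.klFun u ≤ InformationTheory.klFun v := by
      refine (monotoneOn_of_deriv_nonneg (f := InformationTheory.klFun) (convex_Ici 1)
        InformationTheory.continuous_klFun.continuousOn (fun x hx => ?_) fun x hx => ?_)
        (Set.mem_Ici.2 h1) (Set.mem_Ici.2 (h1.trans huv)) huv
      · rw [interior_Ici] at hx
        exact (InformationTheory.hasDerivAt_klFun
          (zero_lt_one.trans hx).ne').differentiableAt.differentiableWithinAt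
      · rw [interior_Ici] at hx
        rw [InformationTheory.deriv_klFun]
        exact Real.log_nonneg (le_of_lt hx)
    linarith

/-! ### Truncation: from bounded signals to finite second moments -/

section Truncation

variable {X ι κ : Type*}

/-- The values of the signal at which the coordinates of `B` are at most `n`. -/
def boundedSet (B : X → ι → ℝ) (n : ℕ) : Set X := {x | ∀ i, |B x i| ≤ n}

lemma monotone_boundedSet (B : X → ι → ℝ) : Monotone (boundedSet B) := fun _ _ h _ hx i =>
  (hx i).trans (by exact_mod_cast h)

lemma iUnion_boundedSet [Fintype ι] (B : X → ι → ℝ) : ⋃ n, boundedSet B n = Set.univ := by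
  refine Set.eq_univ_of_forall fun x => Set.mem_iUnion.2 ?_
  obtain ⟨n, hn⟩ := exists_nat_ge (∑ i, |B x i|)
  exact ⟨n, fun i => (Finset.single_le_sum (f := fun i => |B x i|) (fun i _ => abs_nonneg _)
    (Finset.mem_univ i)).trans hn⟩

variable [Fintype ι] [Fintype κ] [MeasurableSpace X] {P : Measure X}

lemma measurableSet_boundedSet {B : X → ι → ℝ} (hB : Measurable B) (n : ℕ) :
    MeasurableSet (boundedSet B n) := by
  have : boundedSet B n = ⋂ i, {x | |B x i| ≤ n} := by ext; simp [boundedSet]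
  rw [this]
  exact MeasurableSet.iInter fun i =>
    measurableSet_le (_root_.measurable_abs.comp ((measurable_pi_apply i).comp hB)) measurable_const

lemma tendsto_moment_restrict {B : X → ι → ℝ} (hB : Measurable B) {s : ℕ → Set X}
    (hs : ∀ n, MeasurableSet (s n)) (hmono : Monotone s) (hU : ⋃ n, s n = Set.univ) {h : X → ℝ}
    (hh : Integrable h P) (z : ι → ℝ) :
    Tendsto (fun n => moment (P.restrict (s n)) B h z) atTop (𝓝 (moment P B h z)) := by
  have := tendsto_setIntegral_of_monotone hs hmono (f := fun x => h x * likRatio (B x) z) (μ := P)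
    (integrable_mul_likRatio hB hh z).integrableOn
  rwa [hU, Measure.restrict_univ] at this

lemma moment_restrict_le [IsFiniteMeasure P] {B : X → ι → ℝ} (hB : Measurable B) (s : Set X)
    {h : X → ℝ} (hh : Integrable h P) (h0 : ∀ x, 0 ≤ h x) (z : ι → ℝ) :
    moment (P.restrict s) B h z ≤ moment P B h z :=
  setIntegral_le_integral (integrable_mul_likRatio hB hh z)
    (ae_of_all _ fun x => mul_nonneg (h0 x) (likRatio_pos _ z).le)

lemma tendsto_integral_klFun_moment_restrict [IsProbabilityMeasure P] {B : X → ι → ℝ}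
    (hB : Measurable B) (hB2 : ∀ j, MemLp (fun x => B x j) 2 P) {s : ℕ → Set X}
    (hs : ∀ n, MeasurableSet (s n)) (hmono : Monotone s) (hU : ⋃ n, s n = Set.univ) :
    Tendsto (fun n => ∫ z, InformationTheory.klFun (moment (P.restrict (s n)) B (fun _ => 1) z)
      ∂stdGauss ι) atTop
      (𝓝 (∫ z, InformationTheory.klFun (moment P B (fun _ => 1) z) ∂stdGauss ι)) := by
  refine tendsto_integral_of_dominated_convergence
    (fun z => 1 + InformationTheory.klFun (moment P B (fun _ => 1) z))
    (fun n => (InformationTheory.measurable_klFun.comp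
      (measurable_moment hB measurable_const)).aestronglyMeasurable)
    ((integrable_const 1).add (integrable_klFun_moment hB hB2)) (fun n => ae_of_all _ fun z => ?_)
    (ae_of_all _ fun z => (InformationTheory.continuous_klFun.tendsto _).comp
      (tendsto_moment_restrict hB hs hmono hU (integrable_const 1) z))
  rw [Real.norm_of_nonneg (InformationTheory.klFun_nonneg (moment_one_nonneg z))]
  exact klFun_le_one_add_klFun (moment_one_nonneg z)
    (moment_restrict_le hB _ (integrable_const 1) (fun _ => zero_le_one) z)

lemma measurable_energy [SFinite P] {B : X → ι → ℝ} (hB : Measurable B) {h : X → ℝ}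
    (hh : Measurable h) :
    Measurable fun z => moment P B h z ^ 2 * (moment P B (fun _ => 1) z)⁻¹ :=
  ((measurable_moment hB hh).pow_const 2).mul (measurable_moment hB measurable_const).inv

lemma energy_nonneg {B : X → ι → ℝ} (h : X → ℝ) (z : ι → ℝ) :
    0 ≤ moment P B h z ^ 2 * (moment P B (fun _ => 1) z)⁻¹ :=
  mul_nonneg (sq_nonneg _) (inv_nonneg.2 (moment_one_nonneg z))

lemma integrable_energy [IsFiniteMeasure P] {B : X → ι → ℝ} (hB : Measurable B) {h : X → ℝ}
    (hm : Measurable h) (hh : MemLp h 2 P) :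
    Integrable (fun z => moment P B h z ^ 2 * (moment P B (fun _ => 1) z)⁻¹) (stdGauss ι) := by
  refine (integrable_moment hB hh.integrable_sq).mono' (measurable_energy hB hm).aestronglyMeasurable
    (ae_of_all _ fun z => ?_)
  rw [Real.norm_of_nonneg (energy_nonneg h z)]
  exact sq_moment_le hB hh z

lemma tendsto_integral_energy_restrict [IsProbabilityMeasure P] {B : X → ι → ℝ}
    (hB : Measurable B) {h : X → ℝ} (hm : Measurable h) (hh : MemLp h 2 P) {s : ℕ → Set X}
    (hs : ∀ n, MeasurableSet (s n)) (hmono : Monotone s) (hU : ⋃ n, s n = Set.univ) :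
    Tendsto (fun n => ∫ z, moment (P.restrict (s n)) B h z ^ 2 *
        (moment (P.restrict (s n)) B (fun _ => 1) z)⁻¹ ∂stdGauss ι) atTop
      (𝓝 (∫ z, moment P B h z ^ 2 * (moment P B (fun _ => 1) z)⁻¹ ∂stdGauss ι)) := by
  refine tendsto_integral_of_dominated_convergence (moment P B (fun x => h x ^ 2))
    (fun n => (measurable_energy hB hm).aestronglyMeasurable)
    (integrable_moment hB hh.integrable_sq) (fun n => ae_of_all _ fun z => ?_)
    (ae_of_all _ fun z => ?_)
  · rw [Real.norm_of_nonneg (energy_nonneg h z)]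
    exact (sq_moment_le hB (hh.restrict _) z).trans
      (moment_restrict_le hB _ hh.integrable_sq (fun x => sq_nonneg _) z)
  · exact ((tendsto_moment_restrict hB hs hmono hU (hh.integrable one_le_two) z).pow 2).mul
      ((tendsto_moment_restrict hB hs hmono hU (integrable_const 1) z).inv₀
        (moment_one_pos hB z).ne')

lemma moment_restrict_congr {s : Set X} (hs : MeasurableSet s) {B C : X → ι → ℝ} {h k : X → ℝ}
    (hBC : ∀ x ∈ s, B x = C x) (hhk : ∀ x ∈ s, h x = k x) :
    moment (P.restrict s) B h = moment (P.restrict s) C k := by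
  funext z
  exact setIntegral_congr_fun hs fun x hx => by simp only [hBC x hx, hhk x hx]

/-- Convexity of the relative entropy in the channel, for signals with finite second moments. -/
lemma entropy_add_le [IsProbabilityMeasure P] {B : X → ι → ℝ} {B' : X → κ → ℝ}
    (hB : Measurable B) (hB' : Measurable B') (hB2 : ∀ j, MemLp (fun x => B x j) 2 P)
    (hB2' : ∀ j, MemLp (fun x => B' x j) 2 P) :
    ∫ z, InformationTheory.klFun (moment P B (fun _ => 1) z) ∂stdGauss ι
      + 1 / 2 * (∑ k, ∫ z, moment P B (fun x => B' x k) z ^ 2 * (moment P B (fun _ => 1) z)⁻¹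
          ∂stdGauss ι
        - ∑ k, ∫ z, moment P B (fun x => B x k) z ^ 2 * (moment P B (fun _ => 1) z)⁻¹ ∂stdGauss ι)
    ≤ ∫ z, InformationTheory.klFun (moment P B' (fun _ => 1) z) ∂stdGauss κ := by
  -- The prior is restricted to the set where both channel means are bounded by `n`, without
  -- renormalizing: this keeps the moments of nonnegative functions below the original ones.
  set s : ℕ → Set X := fun n => boundedSet B n ∩ boundedSet B' n with hsdef
  have hs : ∀ n, MeasurableSet (s n) := fun n =>
    (measurableSet_boundedSet hB n).inter (measurableSet_boundedSet hB' n)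
  have hmono : Monotone s := fun m n h =>
    Set.inter_subset_inter (monotone_boundedSet B h) (monotone_boundedSet B' h)
  have hU : ⋃ n, s n = Set.univ := by
    rw [hsdef, Set.iUnion_inter_of_monotone (monotone_boundedSet B) (monotone_boundedSet B'),
      iUnion_boundedSet, iUnion_boundedSet, Set.univ_inter]
  have hBi : ∀ i, Measurable fun x => B x i := fun i => (measurable_pi_apply i).comp hB
  have hBi' : ∀ i, Measurable fun x => B' x i := fun i => (measurable_pi_apply i).comp hB'
  refine le_of_tendsto_of_tendsto
    ((tendsto_integral_klFun_moment_restrict hB hB2 hs hmono hU).add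
      (((tendsto_finsetSum _ fun k _ =>
        tendsto_integral_energy_restrict hB (hBi' k) (hB2' k) hs hmono hU).sub
      (tendsto_finsetSum _ fun k _ =>
        tendsto_integral_energy_restrict hB (hBi k) (hB2 k) hs hmono hU)).const_mul (1 / 2)))
    (tendsto_integral_klFun_moment_restrict hB' hB2' hs hmono hU) ?_
  -- The bounded case divides by the moment of `1`, so the restricted prior must be nonzero; this
  -- holds for large `n`.
  have hpos : ∀ᶠ n in atTop, P (s n) ≠ 0 := by
    have h1 := tendsto_measure_iUnion_atTop (μ := P) hmono
    rw [hU, measure_univ] at h1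
    exact (h1.eventually (lt_mem_nhds one_pos)).mono fun n hn => ne_of_gt hn
  filter_upwards [hpos] with n hn
  have : NeZero (P.restrict (s n)) := ⟨by rwa [Ne, Measure.restrict_eq_zero]⟩
  -- Setting the means to zero off the set makes them bounded everywhere and changes no moment of
  -- the restricted prior.
  set C : X → ι → ℝ := (s n).indicator B
  set C' : X → κ → ℝ := (s n).indicator B'
  have hC : ∀ x ∈ s n, C x = B x := fun x hx => Set.indicator_of_mem hx _
  have hC' : ∀ x ∈ s n, C' x = B' x := fun x hx => Set.indicator_of_mem hx _
  have hCm : Measurable C := hB.indicator (hs n)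
  have hCm' : Measurable C' := hB'.indicator (hs n)
  have hCb : ∀ i, BddMeas fun x => C x i := fun i => by
    refine ⟨(measurable_pi_apply i).comp hCm, n, fun x => ?_⟩
    by_cases hx : x ∈ s n
    · simpa only [hC x hx] using hx.1 i
    · simp [C, Set.indicator_of_notMem hx]
  have hCb' : ∀ i, BddMeas fun x => C' x i := fun i => by
    refine ⟨(measurable_pi_apply i).comp hCm', n, fun x => ?_⟩
    by_cases hx : x ∈ s n
    · simpa only [hC' x hx] using hx.2 i
    · simp [C', Set.indicator_of_notMem hx]
  have key := entropy_add_le_of_bddMeas (ν := P.restrict (s n)) hCb hCb'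
  have e1 := moment_restrict_congr (P := P) (hs n) hC fun x _ => rfl (a := (1 : ℝ))
  have e2 := moment_restrict_congr (P := P) (hs n) hC' fun x _ => rfl (a := (1 : ℝ))
  have e3 := fun k => moment_restrict_congr (P := P) (hs n) hC fun x hx => congrFun (hC x hx) k
  have e4 := fun k => moment_restrict_congr (P := P) (hs n) hC fun x hx => congrFun (hC' x hx) k
  simp only [e1, e2, e3, e4] at key
  have i1 := fun k => integrable_energy (P := P.restrict (s n)) hB (hBi k) ((hB2 k).restrict _)
  have i2 := fun k => integrable_energy (P := P.restrict (s n)) hB (hBi' k) ((hB2' k).restrict _)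
  rw [integral_sub (integrable_finsetSum _ fun k _ => i2 k)
    (integrable_finsetSum _ fun k _ => i1 k), integral_finsetSum _ fun k _ => i1 k,
    integral_finsetSum _ fun k _ => i2 k] at key
  exact key

end Truncation

/-! ### Upper semicontinuity of the overlap -/

section Fatou

variable {X ι : Type*} [Fintype ι] [MeasurableSpace X] {P : Measure X}

lemma tendsto_moment {B : X → ι → ℝ} {Bn : ℕ → X → ι → ℝ} (hBn : ∀ n, Measurable (Bn n))
    (hlim : ∀ x, Tendsto (fun n => Bn n x) atTop (𝓝 (B x))) {h : X → ℝ} (hh : Integrable h P)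
    (z : ι → ℝ) : Tendsto (fun n => moment P (Bn n) h z) atTop (𝓝 (moment P B h z)) := by
  refine tendsto_integral_of_dominated_convergence
    (fun x => ‖h x‖ * Real.exp (∑ j, z j ^ 2 / 2))
    (fun n => hh.aestronglyMeasurable.mul
      (measurable_likRatio_left (hBn n) z).aestronglyMeasurable)
    (hh.norm.mul_const _) (fun n => ae_of_all _ fun x => ?_) (ae_of_all _ fun x => ?_)
  · rw [norm_mul, Real.norm_of_nonneg (likRatio_pos _ z).le]
    exact mul_le_mul_of_nonneg_left (likRatio_le _ z) (norm_nonneg _)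
  · have hc : Continuous fun b : ι → ℝ => likRatio b z := by
      unfold likRatio
      fun_prop
    exact ((hc.tendsto _).comp (hlim x)).const_mul _

/-- Upper semicontinuity of the overlap, from Fatou's lemma for the conditional variance. -/
lemma le_integral_energy_of_tendsto [IsProbabilityMeasure P] {B : X → ι → ℝ}
    {Bn : ℕ → X → ι → ℝ} (hB : Measurable B) (hBn : ∀ n, Measurable (Bn n))
    (hlim : ∀ x, Tendsto (fun n => Bn n x) atTop (𝓝 (B x))) {h : X → ℝ} (hm : Measurable h)
    (hh : MemLp h 2 P) {c : ℝ}
    (hc : ∀ n, c ≤ ∫ z, moment P (Bn n) h z ^ 2 * (moment P (Bn n) (fun _ => 1) z)⁻¹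
      ∂stdGauss ι) :
    c ≤ ∫ z, moment P B h z ^ 2 * (moment P B (fun _ => 1) z)⁻¹ ∂stdGauss ι := by
  -- The conditional variance of `h` times the output density. It is nonnegative, and its integral
  -- plus the energy is `E[h²]` for every channel, so Fatou's lower bound for the variance is an
  -- upper bound for the energy.
  set r : (X → ι → ℝ) → (ι → ℝ) → ℝ := fun B z => moment P B (fun x => h x ^ 2) z
    - moment P B h z ^ 2 * (moment P B (fun _ => 1) z)⁻¹ with hr
  have hrm : ∀ B, Measurable B → Measurable (r B) := fun B hB =>
    (measurable_moment hB (hm.pow_const 2)).sub (measurable_energy hB hm)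
  have hr0 : ∀ B, Measurable B → ∀ z, 0 ≤ r B z := fun B hB z =>
    sub_nonneg.2 (sq_moment_le hB hh z)
  have hri : ∀ B, Measurable B → Integrable (r B) (stdGauss ι) := fun B hB =>
    (integrable_moment hB hh.integrable_sq).sub (integrable_energy hB hm hh)
  have hrI : ∀ B, Measurable B → ∫ z, r B z ∂stdGauss ι = ∫ x, h x ^ 2 ∂P
      - ∫ z, moment P B h z ^ 2 * (moment P B (fun _ => 1) z)⁻¹ ∂stdGauss ι := fun B hB => by
    rw [hr, integral_sub (integrable_moment hB hh.integrable_sq) (integrable_energy hB hm hh),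
      integral_moment hB hh.integrable_sq]
  have hrL : ∀ B, Measurable B → ∫⁻ z, ENNReal.ofReal (r B z) ∂stdGauss ι
      = ENNReal.ofReal (∫ z, r B z ∂stdGauss ι) := fun B hB =>
    (ofReal_integral_eq_lintegral_ofReal (hri B hB) (ae_of_all _ (hr0 B hB))).symm
  have hpt : ∀ z, Tendsto (fun n => r (Bn n) z) atTop (𝓝 (r B z)) := fun z =>
    (tendsto_moment hBn hlim hh.integrable_sq z).sub
      (((tendsto_moment hBn hlim (hh.integrable one_le_two) z).pow 2).mul
        ((tendsto_moment hBn hlim (integrable_const 1) z).inv₀ (moment_one_pos hB z).ne'))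
  have hF := lintegral_liminf_le (μ := stdGauss ι) (u := atTop)
    (f := fun n z => ENNReal.ofReal (r (Bn n) z)) fun n => (hrm _ (hBn n)).ennreal_ofReal
  have e1 : ∀ z, liminf (fun n => ENNReal.ofReal (r (Bn n) z)) atTop = ENNReal.ofReal (r B z) :=
    fun z => ((ENNReal.continuous_ofReal.tendsto _).comp (hpt z)).liminf_eq
  simp only [e1, hrL _ hB, hrL _ (hBn _)] at hF
  have h1 : ∀ n, ∫ z, r (Bn n) z ∂stdGauss ι ≤ ∫ x, h x ^ 2 ∂P - c := fun n => by
    rw [hrI _ (hBn n)]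
    linarith [hc n]
  have h2 : 0 ≤ ∫ x, h x ^ 2 ∂P - c := (integral_nonneg (hr0 _ (hBn 0))).trans (h1 0)
  have h3 : ENNReal.ofReal (∫ z, r B z ∂stdGauss ι) ≤ ENNReal.ofReal (∫ x, h x ^ 2 ∂P - c) :=
    hF.trans (liminf_le_of_le (by isBoundedDefault) fun b hb =>
      hb.exists.choose_spec.trans (ENNReal.ofReal_le_ofReal (h1 _)))
  rw [ENNReal.ofReal_le_ofReal_iff h2, hrI _ hB] at h3
  linarith

end Fatou

/-! ### The channel for one row: entropy, overlap and the subgradient inequality -/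

section Channel

variable {n d : ℕ} {P : Measure (Fin d → ℝ)} {S R : Matrix (Fin d) (Fin d) ℝ}

/-- The noiseless output `S^{1/2} x` of the channel for one row. -/
def rowMean (S : Matrix (Fin d) (Fin d) ℝ) (x : Fin d → ℝ) : Fin d → ℝ := (CFC.sqrt S).mulVec x

/-- The overlap `E[E[X | Y] E[X | Y]ᵀ]` of the channel for one row. -/
def rowOverlap (P : Measure (Fin d → ℝ)) (S : Matrix (Fin d) (Fin d) ℝ) :
    Matrix (Fin d) (Fin d) ℝ :=
  Matrix.of fun k l => ∫ z, moment P (rowMean S) (fun x => x k) z *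
    moment P (rowMean S) (fun x => x l) z * (moment P (rowMean S) (fun _ => 1) z)⁻¹
      ∂stdGauss (Fin d)

lemma measurable_rowMean (S : Matrix (Fin d) (Fin d) ℝ) : Measurable (rowMean S) :=
  (Continuous.matrix_mulVec continuous_const continuous_id).measurable

lemma memLp_dotProduct (hP : ∀ i, MemLp (fun x : Fin d → ℝ => x i) 2 P) (v : Fin d → ℝ) :
    MemLp (fun x => v ⬝ᵥ x) 2 P :=
  memLp_finsetSum _ fun i _ => (hP i).const_mul (v i)

lemma measurable_dotProduct_right (v : Fin d → ℝ) : Measurable fun x => v ⬝ᵥ x :=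
  Finset.measurable_fun_sum _ fun i _ => measurable_const.mul (measurable_pi_apply i)

lemma sqrt_isSymm (S : Matrix (Fin d) (Fin d) ℝ) (i j : Fin d) :
    CFC.sqrt S i j = CFC.sqrt S j i := by
  have := (Matrix.nonneg_iff_posSemidef.1 (CFC.sqrt_nonneg S)).isHermitian.apply i j
  simpa using this.symm

lemma relEntropy_eq_lintegral [IsProbabilityMeasure P] (R : Matrix (Fin d) (Fin d) ℝ) :
    relEntropy P R = ∫⁻ z, ENNReal.ofReal
      (InformationTheory.klFun (moment P (rowMean R) (fun _ => 1) z)) ∂stdGauss (Fin d) := by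
  have hm := measurable_rowMean R
  have hg : Measurable fun z => ENNReal.ofReal (moment P (rowMean R) (fun _ => 1) z) :=
    (measurable_moment hm measurable_const).ennreal_ofReal
  have hmap := map_prod_stdGauss_eq_withDensity (P := P) hm
  have hprob : IsProbabilityMeasure
      ((P.prod (stdGauss (Fin d))).map fun p => rowMean R p.1 + p.2) :=
    Measure.isProbabilityMeasure_map
      ((hm.comp measurable_fst).add measurable_snd).aemeasurable
  rw [hmap] at hprob
  change InformationTheory.klDiv ((P.prod (stdGauss (Fin d))).map fun p => rowMean R p.1 + p.2)
    (stdGauss (Fin d)) = _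
  rw [hmap, InformationTheory.klDiv_eq_lintegral_klFun_of_ac (withDensity_absolutelyContinuous _ _)]
  refine lintegral_congr_ae ((Measure.rnDeriv_withDensity _ hg).mono fun z hz => ?_)
  simp only [hz, ENNReal.toReal_ofReal (moment_one_nonneg z)]

/-- The relative entropy as a real number. -/
def entropy (P : Measure (Fin d → ℝ)) (R : Matrix (Fin d) (Fin d) ℝ) : ℝ :=
  ∫ z, InformationTheory.klFun (moment P (rowMean R) (fun _ => 1) z) ∂stdGauss (Fin d)

lemma memLp_rowMean (hP : ∀ i, MemLp (fun x : Fin d → ℝ => x i) 2 P)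
    (R : Matrix (Fin d) (Fin d) ℝ) (j : Fin d) : MemLp (fun x => rowMean R x j) 2 P :=
  memLp_dotProduct hP _

lemma relEntropy_eq_ofReal [IsProbabilityMeasure P]
    (hP : ∀ i, MemLp (fun x : Fin d → ℝ => x i) 2 P) (R : Matrix (Fin d) (Fin d) ℝ) :
    relEntropy P R = ENNReal.ofReal (entropy P R) := by
  rw [relEntropy_eq_lintegral, entropy, ofReal_integral_eq_lintegral_ofReal
    (integrable_klFun_moment (measurable_rowMean R) (memLp_rowMean hP R))
    (ae_of_all _ fun z => InformationTheory.klFun_nonneg (moment_one_nonneg z))]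

lemma entropy_nonneg (R : Matrix (Fin d) (Fin d) ℝ) : 0 ≤ entropy P R :=
  integral_nonneg fun z => InformationTheory.klFun_nonneg (moment_one_nonneg z)

lemma integrable_rowOverlap [IsProbabilityMeasure P]
    (hP : ∀ i, MemLp (fun x : Fin d → ℝ => x i) 2 P) (S : Matrix (Fin d) (Fin d) ℝ)
    (k l : Fin d) :
    Integrable (fun z => moment P (rowMean S) (fun x => x k) z *
      moment P (rowMean S) (fun x => x l) z * (moment P (rowMean S) (fun _ => 1) z)⁻¹)
        (stdGauss (Fin d)) := by
  have hm := measurable_rowMean S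
  have hk := fun k => integrable_energy hm (measurable_pi_apply k) (hP k)
  have hmk : ∀ k : Fin d, Measurable (moment P (rowMean S) fun x => x k) := fun k =>
    measurable_moment hm (measurable_pi_apply k)
  refine ((hk k).add (hk l)).mono' (((hmk k).mul (hmk l)).mul
    (measurable_moment hm measurable_const).inv).aestronglyMeasurable (ae_of_all _ fun z => ?_)
  have h0 := inv_nonneg.2 (moment_one_nonneg (P := P) (B := rowMean S) z)
  rw [norm_mul, Real.norm_of_nonneg h0, Pi.add_apply, ← add_mul, Real.norm_eq_abs]
  refine mul_le_mul_of_nonneg_right (abs_le.2 ?_) h0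
  constructor <;>
  nlinarith [sq_nonneg (moment P (rowMean S) (fun x => x k) z
    + moment P (rowMean S) (fun x => x l) z), sq_nonneg (moment P (rowMean S) (fun x => x k) z
    - moment P (rowMean S) (fun x => x l) z), sq_nonneg (moment P (rowMean S) (fun x => x k) z),
    sq_nonneg (moment P (rowMean S) (fun x => x l) z)]

lemma moment_dotProduct [IsProbabilityMeasure P]
    (hP : ∀ i, MemLp (fun x : Fin d → ℝ => x i) 2 P) (S : Matrix (Fin d) (Fin d) ℝ)
    (v z : Fin d → ℝ) : moment P (rowMean S) (fun x => v ⬝ᵥ x) z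
      = ∑ k, v k * moment P (rowMean S) (fun x => x k) z := by
  simp only [moment, dotProduct, Finset.sum_mul, mul_assoc]
  rw [integral_finsetSum _ fun k _ => (integrable_mul_likRatio (measurable_rowMean S)
    ((hP k).integrable one_le_two) z).const_mul _]
  simp only [integral_const_mul]

/-- Energies of linear functionals are the quadratic form of the overlap matrix, which turns scalar
inequalities for energies into Loewner ones. -/
lemma integral_energy_dotProduct [IsProbabilityMeasure P]
    (hP : ∀ i, MemLp (fun x : Fin d → ℝ => x i) 2 P) (S : Matrix (Fin d) (Fin d) ℝ)
    (v : Fin d → ℝ) :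
    ∫ z, moment P (rowMean S) (fun x => v ⬝ᵥ x) z ^ 2 *
      (moment P (rowMean S) (fun _ => 1) z)⁻¹ ∂stdGauss (Fin d)
      = v ⬝ᵥ (rowOverlap P S).mulVec v := by
  have e : ∀ z, moment P (rowMean S) (fun x => v ⬝ᵥ x) z ^ 2 *
      (moment P (rowMean S) (fun _ => 1) z)⁻¹
      = ∑ k, ∑ l, v k * v l * (moment P (rowMean S) (fun x => x k) z *
      moment P (rowMean S) (fun x => x l) z * (moment P (rowMean S) (fun _ => 1) z)⁻¹) := by
    intro z
    rw [moment_dotProduct hP, pow_two, Finset.sum_mul_sum, Finset.sum_mul]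
    refine Finset.sum_congr rfl fun k _ => ?_
    rw [Finset.sum_mul]
    exact Finset.sum_congr rfl fun l _ => by ring
  have hi := fun k l => (integrable_rowOverlap hP S k l).const_mul (v k * v l)
  simp only [e]
  rw [integral_finsetSum _ fun k _ => integrable_finsetSum _ fun l _ => hi k l]
  refine Finset.sum_congr rfl fun k _ => ?_
  rw [integral_finsetSum _ fun l _ => hi k l, Matrix.mulVec, dotProduct, Finset.mul_sum]
  refine Finset.sum_congr rfl fun l _ => ?_
  rw [integral_const_mul, rowOverlap, Matrix.of_apply]
  ring

/-- The rows of `R^{1/2}` are the functionals observed by the channel. Summing their energies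
recombines the roots into `R`, so the energy of one channel's means is linear in its SNR matrix. -/
lemma sum_sqrt_quadForm (hR : R.PosSemidef) (M : Matrix (Fin d) (Fin d) ℝ) :
    ∑ k, (CFC.sqrt R) k ⬝ᵥ M.mulVec ((CFC.sqrt R) k) = frobInner R M := by
  have hs : CFC.sqrt R * CFC.sqrt R = R :=
    CFC.sqrt_mul_sqrt_self R (Matrix.nonneg_iff_posSemidef.2 hR)
  have ht : (CFC.sqrt R).transpose = CFC.sqrt R := by
    ext i j
    rw [Matrix.transpose_apply, sqrt_isSymm]
  have hRt : R.transpose = R := by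
    conv_lhs => rw [← hs]
    rw [Matrix.transpose_mul, ht, hs]
  have h1 : ∀ k, (CFC.sqrt R) k ⬝ᵥ M.mulVec ((CFC.sqrt R) k)
      = (CFC.sqrt R * (M * (CFC.sqrt R).transpose)) k k := fun k => rfl
  simp only [h1]
  rw [frobInner, hRt]
  conv_rhs => rw [← hs]
  rw [mul_assoc, Matrix.trace_mul_comm, mul_assoc, ht]
  simp only [Matrix.trace, Matrix.diag]

/-- The relative entropy is convex with gradient half the overlap. -/
lemma entropy_add_frobInner_le [IsProbabilityMeasure P]
    (hP : ∀ i, MemLp (fun x : Fin d → ℝ => x i) 2 P) (hS : S.PosSemidef) (hR : R.PosSemidef) :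
    entropy P S + 1 / 2 * (frobInner R (rowOverlap P S) - frobInner S (rowOverlap P S))
      ≤ entropy P R := by
  have key := entropy_add_le (measurable_rowMean S) (measurable_rowMean R) (memLp_rowMean hP S)
    (memLp_rowMean hP R)
  have e : ∀ (R : Matrix (Fin d) (Fin d) ℝ) k, ∫ z, moment P (rowMean S) (fun x => rowMean R x k) z
      ^ 2 * (moment P (rowMean S) (fun _ => 1) z)⁻¹ ∂stdGauss (Fin d) = _ := fun R k =>
    integral_energy_dotProduct hP S (CFC.sqrt R k)
  simp only [e, sum_sqrt_quadForm hR, sum_sqrt_quadForm hS] at key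
  exact key

lemma rowOverlap_isSymm (S : Matrix (Fin d) (Fin d) ℝ) : (rowOverlap P S).IsHermitian := by
  ext k l
  simp only [rowOverlap, Matrix.conjTranspose_apply, Matrix.of_apply, star_trivial,
    mul_comm (moment P (rowMean S) (fun x => x l) _)]

lemma posSemidef_rowOverlap [IsProbabilityMeasure P]
    (hP : ∀ i, MemLp (fun x : Fin d → ℝ => x i) 2 P) (S : Matrix (Fin d) (Fin d) ℝ) :
    (rowOverlap P S).PosSemidef := by
  refine Matrix.posSemidef_iff_dotProduct_mulVec.2 ⟨rowOverlap_isSymm S, fun v => ?_⟩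
  rw [star_trivial, ← integral_energy_dotProduct hP]
  exact integral_nonneg fun z => energy_nonneg _ z

lemma dotProduct_secondMoment [IsProbabilityMeasure P]
    (hP : ∀ i, MemLp (fun x : Fin d → ℝ => x i) 2 P) (v : Fin d → ℝ) :
    v ⬝ᵥ (secondMoment P).mulVec v = ∫ x, (v ⬝ᵥ x) ^ 2 ∂P := by
  have e : ∀ x : Fin d → ℝ, (v ⬝ᵥ x) ^ 2 = ∑ k, ∑ l, v k * v l * (x k * x l) := by
    intro x
    rw [dotProduct, pow_two, Finset.sum_mul_sum]
    exact Finset.sum_congr rfl fun k _ => Finset.sum_congr rfl fun l _ => by ring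
  have hi : ∀ k l, Integrable (fun x : Fin d → ℝ => v k * v l * (x k * x l)) P := fun k l =>
    ((hP k).integrable_mul (hP l)).const_mul (v k * v l)
  simp only [e]
  rw [integral_finsetSum _ fun k _ => integrable_finsetSum _ fun l _ => hi k l]
  refine Finset.sum_congr rfl fun k _ => ?_
  rw [integral_finsetSum _ fun l _ => hi k l, Matrix.mulVec, dotProduct, Finset.mul_sum]
  refine Finset.sum_congr rfl fun l _ => ?_
  rw [integral_const_mul, secondMoment, Matrix.of_apply]
  ring

/-- The upper bound is Jensen's inequality for the conditional mean of each functional `v ⬝ᵥ x`. -/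
lemma rowOverlap_mem_feasible [IsProbabilityMeasure P]
    (hP : ∀ i, MemLp (fun x : Fin d → ℝ => x i) 2 P) (S : Matrix (Fin d) (Fin d) ℝ) :
    rowOverlap P S ∈ feasible P := by
  refine ⟨posSemidef_rowOverlap hP S,
    Matrix.posSemidef_iff_dotProduct_mulVec.2 ⟨?_, fun v => ?_⟩⟩
  · refine Matrix.IsHermitian.sub ?_ (rowOverlap_isSymm S)
    ext k l
    simp only [secondMoment, Matrix.conjTranspose_apply, Matrix.of_apply, star_trivial, mul_comm]
  · have hv := memLp_dotProduct hP v
    rw [star_trivial, Matrix.sub_mulVec, dotProduct_sub, dotProduct_secondMoment hP,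
      ← integral_energy_dotProduct hP, sub_nonneg,
      ← integral_moment (measurable_rowMean S) hv.integrable_sq]
    exact integral_mono
      (integrable_energy (measurable_rowMean S) (measurable_dotProduct_right v) hv)
      (integrable_moment (measurable_rowMean S) hv.integrable_sq)
      fun z => sq_moment_le (measurable_rowMean S) hv z

-- The operator norm supplies the C⋆-algebra in which the square root is continuous; its topology on
-- matrices is the entrywise one.
open scoped Matrix.Norms.L2Operator in
lemma continuousOn_sqrt_posSemidef :
    ContinuousOn (CFC.sqrt : Matrix (Fin d) (Fin d) ℝ → _) {S | S.PosSemidef} :=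
  CFC.continuousOn_sqrt.mono fun _ hS => Matrix.nonneg_iff_posSemidef.2 hS

/-- Upper semicontinuity of the overlap in the SNR matrix. -/
lemma le_dotProduct_rowOverlap_of_tendsto [IsProbabilityMeasure P]
    (hP : ∀ i, MemLp (fun x : Fin d → ℝ => x i) 2 P) {Sn : ℕ → Matrix (Fin d) (Fin d) ℝ}
    (hS : S.PosSemidef) (hSn : ∀ n, (Sn n).PosSemidef) (hlim : Tendsto Sn atTop (𝓝 S))
    {v : Fin d → ℝ} {c : ℝ} (hc : ∀ n, c ≤ v ⬝ᵥ (rowOverlap P (Sn n)).mulVec v) :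
    c ≤ v ⬝ᵥ (rowOverlap P S).mulVec v := by
  have h1 : Tendsto (fun n => CFC.sqrt (Sn n)) atTop (𝓝 (CFC.sqrt S)) :=
    (continuousOn_sqrt_posSemidef S hS).tendsto.comp
      (tendsto_nhdsWithin_iff.2 ⟨hlim, Eventually.of_forall hSn⟩)
  simp only [← integral_energy_dotProduct hP] at hc ⊢
  refine le_integral_energy_of_tendsto (measurable_rowMean S) (fun n => measurable_rowMean (Sn n))
    (fun x => ?_) (measurable_dotProduct_right v) (memLp_dotProduct hP v) hc
  have hcont : Continuous fun A : Matrix (Fin d) (Fin d) ℝ => A.mulVec x :=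
    Continuous.matrix_mulVec continuous_id continuous_const
  exact (hcont.tendsto _).comp h1

end Channel

/-! ### Independent rows: reduction to one row -/

section Rows

variable {n d : ℕ} {P : Measure (Fin d → ℝ)} {S : Matrix (Fin d) (Fin d) ℝ}

lemma chanMean_apply (S : Matrix (Fin d) (Fin d) ℝ) (x : Sig n d) (i : Fin n) :
    chanMean S x i = rowMean S (x i) := by
  funext k
  simp only [chanMean, rowMean, Matrix.mulVec, dotProduct]
  exact Finset.sum_congr rfl fun l _ => by rw [sqrt_isSymm S l k, mul_comm]

/-- The factors `exp(-|yₐ|²/2)` do not depend on the signal and cancel in Bayes' formula. -/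
lemma lik_eq_prod (S : Matrix (Fin d) (Fin d) ℝ) (x y : Sig n d) :
    lik S x y = ∏ a, (Real.exp (-∑ k, y a k ^ 2 / 2) * likRatio (rowMean S (x a)) (y a)) := by
  simp only [likRatio, ← Real.exp_add, ← Real.exp_sum, lik, frobSq, Pi.sub_apply, chanMean_apply]
  rw [Finset.mul_sum]
  congr 1
  refine Finset.sum_congr rfl fun a _ => ?_
  rw [Finset.mul_sum, ← Finset.sum_neg_distrib, ← Finset.sum_add_distrib]
  exact Finset.sum_congr rfl fun k _ => by ring

lemma integral_prod_mul_lik [IsProbabilityMeasure P] (S : Matrix (Fin d) (Fin d) ℝ)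
    (h : Fin n → (Fin d → ℝ) → ℝ) (y : Sig n d) :
    ∫ x, (∏ a, h a (x a)) * lik S x y ∂iidPrior P n
      = ∏ a, (Real.exp (-∑ k, y a k ^ 2 / 2) * moment P (rowMean S) (h a) (y a)) := by
  simp only [lik_eq_prod, ← Finset.prod_mul_distrib, iidPrior]
  rw [integral_fintype_prod_eq_prod (fun a x => h a x *
    (Real.exp (-∑ k, y a k ^ 2 / 2) * likRatio (rowMean S x) (y a)))]
  refine Finset.prod_congr rfl fun a _ => ?_
  rw [moment, ← integral_const_mul]
  exact integral_congr_ae (ae_of_all _ fun x => by simp only []; ring)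

/-- For independent rows the denoiser acts on each row separately. -/
lemma denoiser_iidPrior [IsProbabilityMeasure P] (S : Matrix (Fin d) (Fin d) ℝ) (y : Sig n d)
    (i : Fin n) (k : Fin d) : denoiser (iidPrior P n) S y i k
      = moment P (rowMean S) (fun x => x k) (y i) *
        (moment P (rowMean S) (fun _ => 1) (y i))⁻¹ := by
  have h1 : ∀ x : Sig n d, x i k = ∏ a, if a = i then x a k else 1 := fun x => by
    rw [Finset.prod_ite_eq' Finset.univ i fun a => x a k, if_pos (Finset.mem_univ i)]
  have h2 := integral_prod_mul_lik (P := P) S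
    (fun (a : Fin n) (x : Fin d → ℝ) => if a = i then x k else 1) y
  have h3 := integral_prod_mul_lik (P := P) S (fun (_ : Fin n) (_ : Fin d → ℝ) => 1) y
  simp only [Finset.prod_const_one, one_mul] at h3
  simp only [← h1] at h2
  rw [denoiser, posterior, h2, h3, ← Finset.prod_div_distrib]
  rw [Finset.prod_eq_single i]
  · simp only [if_true]
    rw [mul_div_mul_left _ _ (Real.exp_pos _).ne', div_eq_mul_inv]
  · intro a _ ha
    simp only [if_neg ha]
    exact div_self (mul_pos (Real.exp_pos _) (moment_one_pos (measurable_rowMean S) _)).ne'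
  · exact fun h => absurd (Finset.mem_univ i) h

/-- Each output row is itself an output of the one-row channel, hence has the density computed
before. -/
lemma measurePreserving_row [IsProbabilityMeasure P] (S : Matrix (Fin d) (Fin d) ℝ) (i : Fin n) :
    MeasurePreserving (fun y : Sig n d => y i) (channelLaw (iidPrior P n) S)
      ((stdGauss (Fin d)).withDensity fun z =>
        ENNReal.ofReal (moment P (rowMean S) (fun _ => 1) z)) := by
  have hm := measurable_rowMean S
  have hm1 : Measurable fun p : Sig n d × Sig n d => chanMean S p.1 + p.2 := by
    refine measurable_pi_lambda _ fun a => ?_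
    have : (fun p : Sig n d × Sig n d => (chanMean S p.1 + p.2) a)
        = fun p => rowMean S (p.1 a) + p.2 a := by
      funext p
      rw [Pi.add_apply, chanMean_apply]
    rw [this]
    exact (hm.comp ((measurable_pi_apply a).comp measurable_fst)).add
      ((measurable_pi_apply a).comp measurable_snd)
  have hm2 : Measurable fun p : (Fin d → ℝ) × (Fin d → ℝ) => rowMean S p.1 + p.2 :=
    (hm.comp measurable_fst).add measurable_snd
  have hp : MeasurePreserving (Prod.map (Function.eval i) (Function.eval i))
      ((iidPrior P n).prod (noiseLaw n d)) (P.prod (stdGauss (Fin d))) :=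
    MeasurePreserving.prod (μa := Measure.pi fun _ : Fin n => P)
      (μc := Measure.pi fun _ : Fin n => stdGauss (Fin d))
      (measurePreserving_eval (fun _ : Fin n => P) i)
      (measurePreserving_eval (fun _ : Fin n => stdGauss (Fin d)) i)
  refine ⟨measurable_pi_apply i, ?_⟩
  rw [channelLaw, Measure.map_map (measurable_pi_apply i) hm1,
    ← map_prod_stdGauss_eq_withDensity hm, ← hp.map_eq, Measure.map_map hm2 hp.measurable]
  congr 1
  funext p
  simp only [Function.comp_apply, Pi.add_apply, chanMean_apply, Prod.map_fst, Prod.map_snd,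
    Function.eval]

/-- All rows contribute the same matrix, so the average over rows is exact at each size and the
limit is trivial. Size `0` is excluded because there `1 / n` is `0`. -/
lemma overlapAt_iidPrior [IsProbabilityMeasure P]
    (hP : ∀ i, MemLp (fun x : Fin d → ℝ => x i) 2 P) (S : Matrix (Fin d) (Fin d) ℝ) (hn : n ≠ 0) :
    overlapAt (iidPrior P n) S = rowOverlap P S := by
  have hm := measurable_rowMean S
  have hmk : ∀ k : Fin d, Measurable (moment P (rowMean S) fun x => x k) := fun k =>
    measurable_moment hm (measurable_pi_apply k)
  have hg : Measurable (moment P (rowMean S) fun _ => 1) := measurable_moment hm measurable_const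
  ext k l
  set F : (Fin d → ℝ) → ℝ := fun z => moment P (rowMean S) (fun x => x k) z *
    (moment P (rowMean S) (fun _ => 1) z)⁻¹ * (moment P (rowMean S) (fun x => x l) z *
    (moment P (rowMean S) (fun _ => 1) z)⁻¹) with hF
  have hFm : Measurable F := ((hmk k).mul hg.inv).mul ((hmk l).mul hg.inv)
  have hFg : ∀ z, (ENNReal.ofReal (moment P (rowMean S) (fun _ => 1) z)).toReal • F z
      = moment P (rowMean S) (fun x => x k) z *
        moment P (rowMean S) (fun x => x l) z * (moment P (rowMean S) (fun _ => 1) z)⁻¹ := by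
    intro z
    have h0 := (moment_one_pos (P := P) hm z).ne'
    rw [ENNReal.toReal_ofReal (moment_one_nonneg z), smul_eq_mul, hF]
    field_simp
  have hFi : Integrable F ((stdGauss (Fin d)).withDensity fun z =>
        ENNReal.ofReal (moment P (rowMean S) (fun _ => 1) z)) := by
    rw [integrable_withDensity_iff_integrable_smul' hg.ennreal_ofReal
      (ae_of_all _ fun _ => ENNReal.ofReal_lt_top)]
    simp only [hFg]
    exact integrable_rowOverlap hP S k l
  have hrow : ∀ i : Fin n, ∫ y, F (y i) ∂channelLaw (iidPrior P n) S = rowOverlap P S k l := by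
    intro i
    rw [(measurePreserving_row S i).integral_comp_of_measurable hFm,
      integral_withDensity_eq_integral_toReal_smul hg.ennreal_ofReal
        (ae_of_all _ fun _ => ENNReal.ofReal_lt_top)]
    simp only [hFg]
    rfl
  rw [overlapAt, Matrix.of_apply]
  simp only [denoiser_iidPrior]
  change 1 / (n : ℝ) * ∫ y, ∑ i, F (y i) ∂channelLaw (iidPrior P n) S = _
  have hint : ∀ i : Fin n, Integrable (fun y => F (y i)) (channelLaw (iidPrior P n) S) := fun i =>
    (measurePreserving_row S i).integrable_comp_of_integrable hFi
  rw [integral_finsetSum _ fun i _ => hint i]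
  simp only [hrow, Finset.sum_const, Finset.card_univ, Fintype.card_fin, nsmul_eq_mul]
  have : (n : ℝ) ≠ 0 := by exact_mod_cast hn
  field_simp

lemma tendsto_overlapAt_iidPrior [IsProbabilityMeasure P]
    (hP : ∀ i, MemLp (fun x : Fin d → ℝ => x i) 2 P) (S : Matrix (Fin d) (Fin d) ℝ) :
    Tendsto (fun n => overlapAt (iidPrior P n) S) atTop (𝓝 (rowOverlap P S)) :=
  tendsto_const_nhds.congr' ((eventually_ne_atTop 0).mono fun _ hn =>
    (overlapAt_iidPrior hP S hn).symm)

lemma overlap_iidPrior [IsProbabilityMeasure P]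
    (hP : ∀ i, MemLp (fun x : Fin d → ℝ => x i) 2 P) (S : Matrix (Fin d) (Fin d) ℝ) :
    overlap (iidPrior P) S = rowOverlap P S :=
  (tendsto_overlapAt_iidPrior hP S).limUnder_eq

end Rows

/-! ### The coupling as a quadratic form -/

section Coupling

variable {d K : ℕ} {Λ : Fin K → Matrix (Fin d) (Fin d) ℝ}

lemma frobInner_comm (A B : Matrix (Fin d) (Fin d) ℝ) : frobInner A B = frobInner B A := by
  rw [frobInner, ← Matrix.trace_transpose, Matrix.transpose_mul, Matrix.transpose_transpose,
    frobInner]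

lemma frobInner_add_left (A B C : Matrix (Fin d) (Fin d) ℝ) :
    frobInner (A + B) C = frobInner A C + frobInner B C := by
  rw [frobInner, Matrix.transpose_add, add_mul, Matrix.trace_add, frobInner, frobInner]

lemma frobInner_smul_left (c : ℝ) (A B : Matrix (Fin d) (Fin d) ℝ) :
    frobInner (c • A) B = c * frobInner A B := by
  rw [frobInner, Matrix.transpose_smul, smul_mul_assoc, Matrix.trace_smul, frobInner, smul_eq_mul]

lemma frobInner_add_right (A B C : Matrix (Fin d) (Fin d) ℝ) :
    frobInner A (B + C) = frobInner A B + frobInner A C := by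
  rw [frobInner_comm, frobInner_add_left, frobInner_comm B, frobInner_comm C]

lemma frobInner_smul_right (c : ℝ) (A B : Matrix (Fin d) (Fin d) ℝ) :
    frobInner A (c • B) = c * frobInner A B := by
  rw [frobInner_comm, frobInner_smul_left, frobInner_comm]

lemma frobInner_self (A : Matrix (Fin d) (Fin d) ℝ) : frobInner A A = ∑ i, ∑ j, A j i ^ 2 := by
  simp only [frobInner, Matrix.trace, Matrix.diag, Matrix.mul_apply, Matrix.transpose_apply,
    pow_two]

lemma eq_zero_of_frobInner_self {A : Matrix (Fin d) (Fin d) ℝ} (h : frobInner A A = 0) :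
    A = 0 := by
  rw [frobInner_self, Finset.sum_eq_zero_iff_of_nonneg fun i _ =>
    Finset.sum_nonneg fun j _ => sq_nonneg _] at h
  ext j i
  have := (Finset.sum_eq_zero_iff_of_nonneg fun j _ => sq_nonneg _).1 (h i (Finset.mem_univ i)) j
    (Finset.mem_univ j)
  simpa using this

lemma frobInner_vecMulVec (v : Fin d → ℝ) (A : Matrix (Fin d) (Fin d) ℝ) :
    frobInner (Matrix.vecMulVec v v) A = v ⬝ᵥ A.mulVec v := by
  rw [frobInner, Matrix.transpose_vecMulVec, Matrix.vecMulVec_mul, Matrix.trace_vecMulVec,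
    Matrix.dotProduct_mulVec, dotProduct_comm]

lemma coupling_add (A B : Matrix (Fin d) (Fin d) ℝ) :
    coupling Λ (A + B) = coupling Λ A + coupling Λ B := by
  simp only [coupling, mul_add, add_mul, Finset.sum_add_distrib]

lemma coupling_smul (c : ℝ) (A : Matrix (Fin d) (Fin d) ℝ) :
    coupling Λ (c • A) = c • coupling Λ A := by
  simp only [coupling, mul_smul_comm, smul_mul_assoc, Finset.smul_sum]

lemma coupling_isSymm (hΛ : ∀ k, (Λ k).IsSymm) {A : Matrix (Fin d) (Fin d) ℝ} (hA : A.IsSymm) :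
    (coupling Λ A).IsSymm := by
  rw [Matrix.IsSymm, coupling, Matrix.transpose_sum]
  refine Finset.sum_congr rfl fun k _ => ?_
  rw [Matrix.transpose_mul, Matrix.transpose_mul, (hΛ k).eq, hA.eq, mul_assoc]

lemma frobInner_coupling_comm (hΛ : ∀ k, (Λ k).IsSymm) (A B : Matrix (Fin d) (Fin d) ℝ) :
    frobInner (coupling Λ A) B = frobInner A (coupling Λ B) := by
  simp only [frobInner, coupling, Matrix.transpose_sum, Finset.sum_mul, Finset.mul_sum,
    Matrix.trace_sum]
  refine Finset.sum_congr rfl fun k _ => ?_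
  rw [Matrix.transpose_mul, Matrix.transpose_mul, (hΛ k).eq, mul_assoc, Matrix.trace_mul_comm]
  simp only [mul_assoc]

lemma posSemidef_coupling (hΛ : ∀ k, (Λ k).IsSymm) {Q : Matrix (Fin d) (Fin d) ℝ}
    (hQ : Q.PosSemidef) : (coupling Λ Q).PosSemidef := by
  refine Matrix.posSemidef_sum _ fun k _ => ?_
  have := hQ.mul_mul_conjTranspose_same (Λ k)
  rwa [Matrix.conjTranspose_eq_transpose_of_trivial, (hΛ k).eq] at this

/-- A convex quadratic form is nonnegative. -/
lemma frobInner_coupling_self_nonneg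
    (hconv : ConvexOn ℝ {Y : Matrix (Fin d) (Fin d) ℝ | Y.IsSymm}
      fun Y => frobInner (coupling Λ Y) Y) {A : Matrix (Fin d) (Fin d) ℝ} (hA : A.IsSymm) :
    0 ≤ frobInner (coupling Λ A) A := by
  -- The midpoint of `A` and `-A` is `0`, and the form takes the same value at both.
  have hA' : ((-1 : ℝ) • A).IsSymm := hA.smul _
  have h := hconv.2 hA hA' (show (0 : ℝ) ≤ 1 / 2 by norm_num) (show (0 : ℝ) ≤ 1 / 2 by norm_num)
    (by norm_num)
  have e : (1 / 2 : ℝ) • A + (1 / 2 : ℝ) • ((-1 : ℝ) • A) = (0 : ℝ) • A := by module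
  simp only [e, coupling_smul, frobInner_smul_left, frobInner_smul_right, smul_eq_mul] at h
  linarith

/-- A null vector of the nonnegative quadratic form is in the kernel of the coupling. -/
lemma coupling_eq_zero (hΛ : ∀ k, (Λ k).IsSymm)
    (hconv : ConvexOn ℝ {Y : Matrix (Fin d) (Fin d) ℝ | Y.IsSymm}
      fun Y => frobInner (coupling Λ Y) Y) {A : Matrix (Fin d) (Fin d) ℝ} (hA : A.IsSymm)
    (h0 : frobInner (coupling Λ A) A ≤ 0) : coupling Λ A = 0 := by
  set T := coupling Λ A with hT
  have hTs : T.IsSymm := coupling_isSymm hΛ hA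
  have key : ∀ t : ℝ, 0 ≤ 2 * t * frobInner T T + t ^ 2 * frobInner (coupling Λ T) T := by
    intro t
    have h1 : (A + t • T).IsSymm := hA.add (hTs.smul t)
    have h2 := frobInner_coupling_self_nonneg hconv h1
    simp only [coupling_add, coupling_smul, frobInner_add_left, frobInner_add_right,
      frobInner_smul_left, frobInner_smul_right] at h2
    rw [frobInner_coupling_comm hΛ T A, ← hT] at h2
    nlinarith [h2]
  have hq : 0 ≤ frobInner (coupling Λ T) T := frobInner_coupling_self_nonneg hconv hTs
  have hn : 0 ≤ frobInner T T := by
    rw [frobInner_self]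
    exact Finset.sum_nonneg fun i _ => Finset.sum_nonneg fun j _ => sq_nonneg _
  refine eq_zero_of_frobInner_self (le_antisymm ?_ hn)
  by_contra! hlt
  have hq1 : 0 < frobInner (coupling Λ T) T + 1 := by linarith
  -- A nearly optimal `t` for the quadratic in `key`; the `+ 1` keeps the denominator positive when
  -- the form vanishes at `T`.
  have h3 := key (-(frobInner T T / (frobInner (coupling Λ T) T + 1)))
  set a := frobInner T T
  set q := frobInner (coupling Λ T) T
  have h4 : 2 * -(a / (q + 1)) * a + (-(a / (q + 1))) ^ 2 * q
      = -(a ^ 2 * (q + 2) / (q + 1) ^ 2) := by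
    field_simp
    ring
  rw [h4] at h3
  have h5 : 0 < a ^ 2 * (q + 2) / (q + 1) ^ 2 := by positivity
  linarith

/-- Each `Λₖ A Λₖ` is positive semidefinite, so a vanishing sum forces `A Λₖ = 0`. Transposing, `Λₖ
A = 0`, and the range of `A` lies in the common kernel. -/
lemma eq_zero_of_coupling_eq_zero (hΛ : ∀ k, (Λ k).IsSymm) {A : Matrix (Fin d) (Fin d) ℝ}
    (hA : A.PosSemidef) (hker : ∀ v : Fin d → ℝ, (∀ k, (Λ k).mulVec v = 0) → v = 0)
    (h0 : coupling Λ A = 0) : A = 0 := by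
  have hAs : A.transpose = A := hA.isHermitian
  have hmul : ∀ k v, A.mulVec ((Λ k).mulVec v) = 0 := by
    intro k v
    have hnn : ∀ k, 0 ≤ (Λ k).mulVec v ⬝ᵥ A.mulVec ((Λ k).mulVec v) := fun k => by
      simpa using hA.dotProduct_mulVec_nonneg ((Λ k).mulVec v)
    have hsum : ∑ k, (Λ k).mulVec v ⬝ᵥ A.mulVec ((Λ k).mulVec v) = 0 := by
      have h1 : v ⬝ᵥ (coupling Λ A).mulVec v = 0 := by rw [h0]; simp
      rw [coupling, Matrix.sum_mulVec, dotProduct_sum] at h1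
      rw [← h1]
      refine Finset.sum_congr rfl fun k _ => ?_
      rw [← Matrix.mulVec_mulVec, ← Matrix.mulVec_mulVec, Matrix.dotProduct_mulVec v,
        ← Matrix.mulVec_transpose, (hΛ k).eq]
    have := (Finset.sum_eq_zero_iff_of_nonneg fun k _ => hnn k).1 hsum k (Finset.mem_univ k)
    exact (hA.dotProduct_mulVec_zero_iff _).1 (by simpa using this)
  have hcol : ∀ v, A.mulVec v = 0 := by
    intro v
    refine hker _ fun k => ?_
    have h1 : A * Λ k = 0 := by
      ext i j
      have := congrFun (hmul k (Pi.single j 1)) i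
      rw [Matrix.mulVec_single_one] at this
      exact this
    have h2 : Λ k * A = 0 := by
      rw [← hAs, ← (hΛ k).eq, ← Matrix.transpose_mul, h1, Matrix.transpose_zero]
    rw [Matrix.mulVec_mulVec, h2, Matrix.zero_mulVec]
  ext i j
  simpa using congrFun (hcol (Pi.single j 1)) i

end Coupling

/-! ### Maximizers of the potential -/

section FixedPoint

variable {d K : ℕ} {P : Measure (Fin d → ℝ)} [IsProbabilityMeasure P]
  {Λ : Fin K → Matrix (Fin d) (Fin d) ℝ} {Q R S : Matrix (Fin d) (Fin d) ℝ}

lemma potential_le (hP : ∀ i, MemLp (fun x : Fin d → ℝ => x i) 2 P) (hR : R.PosSemidef) :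
    potential P Λ Q
      ≤ ((entropy P R + (frobInner (coupling Λ Q) Q / 4 - frobInner R Q / 2) : ℝ) : EReal) := by
  refine (iInf₂_le R hR).trans (le_of_eq ?_)
  rw [relEntropy_eq_ofReal hP, EReal.coe_ennreal_ofReal, max_eq_left (entropy_nonneg R),
    ← EReal.coe_add]

/-- When the overlap argument is `rowOverlap P S`, the subgradient inequality says exactly that `R =
S` minimizes over `R`. -/
lemma le_potential_rowOverlap (hP : ∀ i, MemLp (fun x : Fin d → ℝ => x i) 2 P)
    (hS : S.PosSemidef) :
    ((entropy P S + (frobInner (coupling Λ (rowOverlap P S)) (rowOverlap P S) / 4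
      - frobInner S (rowOverlap P S) / 2) : ℝ) : EReal) ≤ potential P Λ (rowOverlap P S) := by
  refine le_iInf₂ fun R hR => ?_
  rw [relEntropy_eq_ofReal hP, EReal.coe_ennreal_ofReal, max_eq_left (entropy_nonneg R),
    ← EReal.coe_add, EReal.coe_le_coe_iff]
  linarith [entropy_add_frobInner_le hP hS hR]

/-- If `Q` maximizes the potential, then `Q / 2` is a subgradient of the relative entropy at
`coupling Λ Q`, with a gap given by the quadratic form at the difference to the overlap. -/
lemma entropy_sub_le_of_isMaxOn (hP : ∀ i, MemLp (fun x : Fin d → ℝ => x i) 2 P)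
    (hΛ : ∀ k, (Λ k).IsSymm) (hQ : Q ∈ feasible P)
    (hmax : IsMaxOn (potential P Λ) (feasible P) Q) (hR : R.PosSemidef) :
    entropy P (coupling Λ Q) + frobInner (R - coupling Λ Q) Q / 2
      + frobInner (coupling Λ (rowOverlap P (coupling Λ Q) - Q))
        (rowOverlap P (coupling Λ Q) - Q) / 4 ≤ entropy P R := by
  have hS := posSemidef_coupling hΛ hQ.1
  -- The maximizer is compared with one competitor only, the overlap at its own effective SNR. What
  -- follows completes the square, using that the coupling is self-adjoint.
  have h := (le_potential_rowOverlap (Λ := Λ) hP hS).trans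
    ((hmax (rowOverlap_mem_feasible hP (coupling Λ Q))).trans (potential_le hP hR))
  rw [EReal.coe_le_coe_iff] at h
  set W := rowOverlap P (coupling Λ Q)
  have e : W - Q = W + (-1 : ℝ) • Q := by module
  have e2 : R - coupling Λ Q = R + (-1 : ℝ) • coupling Λ Q := by module
  have e3 := frobInner_coupling_comm hΛ W Q
  rw [frobInner_comm W] at e3
  simp only [e, e2, coupling_add, coupling_smul, frobInner_add_left, frobInner_add_right,
    frobInner_smul_left, frobInner_smul_right, e3]
  linarith

/-- Taking `R = coupling Λ Q` in the previous inequality cancels the entropies and leaves the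
quadratic form at most zero. -/
lemma coupling_rowOverlap_eq (hP : ∀ i, MemLp (fun x : Fin d → ℝ => x i) 2 P)
    (hΛ : ∀ k, (Λ k).IsSymm)
    (hconv : ConvexOn ℝ {Y : Matrix (Fin d) (Fin d) ℝ | Y.IsSymm}
      fun Y => frobInner (coupling Λ Y) Y) (hQ : Q ∈ feasible P)
    (hmax : IsMaxOn (potential P Λ) (feasible P) Q) :
    coupling Λ (rowOverlap P (coupling Λ Q) - Q) = 0 := by
  have hsymm : (rowOverlap P (coupling Λ Q) - Q).IsSymm :=
    (posSemidef_rowOverlap hP _).isHermitian.sub hQ.1.isHermitian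
  refine coupling_eq_zero hΛ hconv hsymm ?_
  have h := entropy_sub_le_of_isMaxOn hP hΛ hQ hmax (posSemidef_coupling hΛ hQ.1)
  have e : coupling Λ Q - coupling Λ Q = (0 : ℝ) • coupling Λ Q := by module
  rw [e, frobInner_smul_left] at h
  linarith

/-- The entropy need not be known to be differentiable at the boundary of the cone. It is enough to
move inside it, from `S = coupling Λ Q` to `S + t vvᵀ`, and to let `t` tend to `0`. -/
lemma posSemidef_rowOverlap_sub (hP : ∀ i, MemLp (fun x : Fin d → ℝ => x i) 2 P)
    (hΛ : ∀ k, (Λ k).IsSymm)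
    (hconv : ConvexOn ℝ {Y : Matrix (Fin d) (Fin d) ℝ | Y.IsSymm}
      fun Y => frobInner (coupling Λ Y) Y) (hQ : Q ∈ feasible P)
    (hmax : IsMaxOn (potential P Λ) (feasible P) Q) :
    (rowOverlap P (coupling Λ Q) - Q).PosSemidef := by
  have hS := posSemidef_coupling hΛ hQ.1
  have hherm := (posSemidef_rowOverlap hP (coupling Λ Q)).isHermitian.sub hQ.1.isHermitian
  refine Matrix.posSemidef_iff_dotProduct_mulVec.2 ⟨hherm, fun v => ?_⟩
  rw [star_trivial, Matrix.sub_mulVec, dotProduct_sub, sub_nonneg]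
  have hv : (Matrix.vecMulVec v v).PosSemidef := by
    simpa using Matrix.posSemidef_vecMulVec_self_star v
  have ht : ∀ n : ℕ, (0 : ℝ) < 1 / ((n : ℝ) + 1) := fun n => by positivity
  have hSn : ∀ n : ℕ, (coupling Λ Q + (1 / ((n : ℝ) + 1)) • Matrix.vecMulVec v v).PosSemidef :=
    fun n => hS.add (hv.smul (ht n).le)
  refine le_dotProduct_rowOverlap_of_tendsto hP hS hSn ?_ fun n => ?_
  · have h1 := (tendsto_one_div_add_atTop_nhds_zero_nat (𝕜 := ℝ)).smul_const
      (Matrix.vecMulVec v v)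
    simpa using h1.const_add (coupling Λ Q)
  · have h1 := entropy_sub_le_of_isMaxOn hP hΛ hQ hmax (hSn n)
    -- The subgradient inequality from the perturbed point back to `coupling Λ Q`, against `h1` in
    -- the other direction: the entropies cancel and `t` times the two quadratic forms at `v` are
    -- compared.
    have h2 := entropy_add_frobInner_le hP (hSn n) hS
    rw [coupling_rowOverlap_eq hP hΛ hconv hQ hmax, add_sub_cancel_left] at h1
    have e : frobInner 0 (rowOverlap P (coupling Λ Q) - Q) = 0 := by simp [frobInner]
    rw [e, frobInner_smul_left, frobInner_vecMulVec] at h1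
    rw [frobInner_add_left, frobInner_smul_left, frobInner_vecMulVec] at h2
    have h3 : 1 / ((n : ℝ) + 1) * (v ⬝ᵥ Q.mulVec v) ≤ 1 / ((n : ℝ) + 1) * (v ⬝ᵥ (rowOverlap P
        (coupling Λ Q + (1 / ((n : ℝ) + 1)) • Matrix.vecMulVec v v)).mulVec v) := by linarith
    exact le_of_mul_le_mul_left h3 (ht n)

end FixedPoint

end MTP

end

theorem mainTheorem7 {d K : ℕ} (P : MeasureTheory.Measure (Fin d → ℝ))
    [MeasureTheory.IsProbabilityMeasure P]
    (hP : ∀ i, MeasureTheory.MemLp (fun x : Fin d → ℝ => x i) 2 P)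
    (hWC : MTP.WeakCorrelation (MTP.iidPrior P))
    (Λ : Fin K → Matrix (Fin d) (Fin d) ℝ) (hΛ : ∀ k, (Λ k).IsSymm)
    (hconv : ConvexOn ℝ {Y : Matrix (Fin d) (Fin d) ℝ | Y.IsSymm}
      (fun Y => MTP.frobInner (MTP.coupling Λ Y) Y)) :
    (∀ S : Matrix (Fin d) (Fin d) ℝ, S.PosSemidef →
      Filter.Tendsto (fun n => MTP.overlapAt (MTP.iidPrior P n) S) Filter.atTop
        (nhds (MTP.overlap (MTP.iidPrior P) S))) ∧
    ∀ Q ∈ MTP.feasible P, IsMaxOn (MTP.potential P Λ) (MTP.feasible P) Q →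
      MTP.coupling Λ Q
        = MTP.coupling Λ (MTP.overlap (MTP.iidPrior P) (MTP.coupling Λ Q)) ∧
      ((∀ v : Fin d → ℝ, (∀ k, (Λ k).mulVec v = 0) → v = 0) →
        Q = MTP.overlap (MTP.iidPrior P) (MTP.coupling Λ Q)) := by
  refine ⟨fun S _ => ?_, fun Q hQ hmax => ?_⟩
  · rw [MTP.overlap_iidPrior hP]
    exact MTP.tendsto_overlapAt_iidPrior hP S
  · rw [MTP.overlap_iidPrior hP]
    have h0 := MTP.coupling_rowOverlap_eq hP hΛ hconv hQ hmax
    refine ⟨?_, fun hker => ?_⟩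
    · have e : MTP.rowOverlap P (MTP.coupling Λ Q)
          = Q + (MTP.rowOverlap P (MTP.coupling Λ Q) - Q) := by abel
      conv_rhs => rw [e, MTP.coupling_add, h0, add_zero]
    · exact (sub_eq_zero.1 (MTP.eq_zero_of_coupling_eq_zero hΛ
        (MTP.posSemidef_rowOverlap_sub hP hΛ hconv hQ hmax) hker h0)).symm
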